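/- **Theorem (Symplectic flowbox coordinates).** Let $d\ge 1$ be an integer and let $s\in\{2,3,4,\dots\}\cup\{\infty\}$ (with $\infty-1=\infty$). Let $M$ be a $C^s$ manifold (without boundary) of dimension $2d$, equipped with a symplectic form $\omega$, i.e. a closed and nondegenerate $2$-form whose coefficients in the charts of $M$ are of class $C^{s-1}$. Let $H\in C^s(M,\mathbb{R})$ and let $X_H$ be its Hamiltonian vector field, determined by $\omega(X_H,\cdot)=dH$. On $\mathbb{R}^{2d}$ with coordinates $y=(y_1,\dots,y_{2d})$ consider the canonical symplectic form $\omega_0=\sum_{i=1}^d dy_i\wedge dy_{d+i}$ and the Hamiltonian $H_0(y)=y_{d+1}$, whose Hamiltonian vector field is $\partial/\partial y_1$. Let $x\in M$ be a regular point of $H$, i.e. $dH(x)\neq 0$. Then there exist an open neighbourhood $U\subset M$ of $x$ and a map $g\colon U\to\mathbb{R}^{2d}$ which is a $C^{s-1}$ diffeomorphism onto an open subset of $\mathbb{R}^{2d}$ (that is, a homeomorphism of $U$ onto an open set $g(U)$ such that $g$ and $g^{-1}$ are of class $C^{s-1}$), such that on $U$ $$g^*\omega_0=\omega,\qquad H=H_0\circ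 g,\qquad g_*X_H=\frac{\partial}{\partial y_1},$$ where the last identity means $Dg(m)\,X_H(m)=\partial/\partial y_1$ for every $m\in U$. -/

import Mathlib

open scoped Manifold

noncomputable section

namespace SymplecticFlowbox

/-! ### Differential 2-forms on manifolds and their pull-backs -/

section Forms

variable {E : Type*} [NormedAddCommGroup E] [NormedSpace ℝ E]
  {E' : Type*} [NormedAddCommGroup E'] [NormedSpace ℝ E']
  {A : Type*} [TopologicalSpace A] {A' : Type*} [TopologicalSpace A']

/-- A (not necessarily continuous) field of alternating bilinear forms on the tangent spaces. -/
abbrev TwoForm (I : ModelWithCorners ℝ E A) (M : Type*) [TopologicalSpace M]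
    [ChartedSpace A M] : Type _ :=
  (m : M) → (TangentSpace I m) [⋀^Fin 2]→L[ℝ] ℝ

/-- The pull-back of a 2-form: `(g^* η)(u, v) = η (Dg u, Dg v)`. -/
def pullback (I : ModelWithCorners ℝ E A) (I' : ModelWithCorners ℝ E' A')
    {M : Type*} [TopologicalSpace M] [ChartedSpace A M]
    {N : Type*} [TopologicalSpace N] [ChartedSpace A' N]
    (g : M → N) (η : TwoForm I' N) : TwoForm I M :=
  fun m => (η (g m)).compContinuousLinearMap (mfderiv I I' g m)

/-- The expression of a 2-form in the preferred chart around `c`, as a function on the model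
vector space: the pull-back by the inverse of the chart (meaningful on the chart's target). -/
def inChart (I : ModelWithCorners ℝ E A) {M : Type*} [TopologicalSpace M] [ChartedSpace A M]
    (η : TwoForm I M) (c : M) : E → E [⋀^Fin 2]→L[ℝ] ℝ :=
  pullback 𝓘(ℝ, E) I (extChartAt I c).symm η

end Forms

/-! ### Symplectic manifolds and Hamiltonian vector fields -/

/-- A symplectic form of class `C^n` on a manifold of dimension `2d` without boundary: a closed
and nondegenerate 2-form with `C^n` coefficients in the charts. -/
structure SymplecticForm (d : ℕ) (n : WithTop ℕ∞) (M : Type*) [TopologicalSpace M]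
    [ChartedSpace (EuclideanSpace ℝ (Fin (2 * d))) M] where
  form : TwoForm (𝓡 (2 * d)) M
  contDiffOn : ∀ c : M,
    ContDiffOn ℝ n (inChart (𝓡 (2 * d)) form c) (extChartAt (𝓡 (2 * d)) c).target
  closed : ∀ c : M, ∀ y ∈ (extChartAt (𝓡 (2 * d)) c).target,
    extDeriv (inChart (𝓡 (2 * d)) form c) y = 0
  nondegenerate : ∀ (m : M) (u : TangentSpace (𝓡 (2 * d)) m),
    (∀ v : TangentSpace (𝓡 (2 * d)) m, form m ![u, v] = 0) → u = 0

section Hamiltonian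

variable {d : ℕ} {n : WithTop ℕ∞} {M : Type*} [TopologicalSpace M]
  [ChartedSpace (EuclideanSpace ℝ (Fin (2 * d))) M]

/-- The differential `dH(m)` as a linear form on the tangent space. -/
def differential (H : M → ℝ) (m : M) : TangentSpace (𝓡 (2 * d)) m →L[ℝ] ℝ :=
  mfderiv (𝓡 (2 * d)) 𝓘(ℝ, ℝ) H m

/-- A point is regular for `H` if `dH` does not vanish there. -/
def IsRegularPoint (d : ℕ) {M : Type*} [TopologicalSpace M]
    [ChartedSpace (EuclideanSpace ℝ (Fin (2 * d))) M] (H : M → ℝ) (m : M) : Prop :=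
  differential (d := d) H m ≠ 0

theorem exists_dual_vector {V : Type*} [NormedAddCommGroup V] [NormedSpace ℝ V]
    [FiniteDimensional ℝ V] (η : V [⋀^Fin 2]→L[ℝ] ℝ)
    (hη : ∀ u : V, (∀ v : V, η ![u, v] = 0) → u = 0) (α : V →L[ℝ] ℝ) :
    ∃ X : V, ∀ v : V, η ![X, v] = α v := by
  have e0 : ∀ a b v : V, Function.update ![a, v] 0 b = ![b, v] := fun a b v => by
    funext i; fin_cases i <;> rfl
  have e1 : ∀ a v b : V, Function.update ![a, v] 1 b = ![a, b] := fun a v b => by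
    funext i; fin_cases i <;> rfl
  let f : V →ₗ[ℝ] Module.Dual ℝ V :=
    LinearMap.mk₂ ℝ (fun u v => η ![u, v])
      (fun a b v => by simpa only [e0] using η.map_update_add ![a, v] 0 a b)
      (fun r a v => by simpa only [e0] using η.map_update_smul ![a, v] 0 r a)
      (fun a v w => by simpa only [e1] using η.map_update_add ![a, v] 1 v w)
      (fun r a v => by simpa only [e1] using η.map_update_smul ![a, v] 1 r v)
  have hinj : Function.Injective f := by
    rw [injective_iff_map_eq_zero]
    exact fun u hu => hη u fun v => LinearMap.congr_fun hu v
  have hsurj : Function.Surjective f :=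
    (LinearMap.injective_iff_surjective_of_finrank_eq_finrank
      (Subspace.dual_finrank_eq (K := ℝ) (V := V)).symm).1 hinj
  obtain ⟨X, hX⟩ := hsurj (α : V →ₗ[ℝ] ℝ)
  exact ⟨X, fun v => LinearMap.congr_fun hX v⟩

theorem SymplecticForm.exists_dual (ω : SymplecticForm d n M) (m : M)
    (α : TangentSpace (𝓡 (2 * d)) m →L[ℝ] ℝ) :
    ∃ X : TangentSpace (𝓡 (2 * d)) m,
      ∀ v : TangentSpace (𝓡 (2 * d)) m, ω.form m ![X, v] = α v :=
  exists_dual_vector (V := EuclideanSpace ℝ (Fin (2 * d))) (ω.form m) (ω.nondegenerate m) α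

/-- The Hamiltonian vector field `X_H`, determined by `ω (X_H, ·) = dH`. -/
def hamiltonianVectorField (ω : SymplecticForm d n M) (H : M → ℝ) (m : M) :
    TangentSpace (𝓡 (2 * d)) m :=
  (ω.exists_dual m (differential H m)).choose

theorem hamiltonianVectorField_spec (ω : SymplecticForm d n M) (H : M → ℝ) (m : M)
    (v : TangentSpace (𝓡 (2 * d)) m) :
    ω.form m ![hamiltonianVectorField ω H m, v] = differential H m v :=
  (ω.exists_dual m (differential H m)).choose_spec v

end Hamiltonian

/-! ### The standard symplectic space `ℝ^{2d}` with coordinates `y_1, …, y_{2d}` -/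

/-- The index of the coordinate `y_i` (indices of `Fin d` start from `0`). -/
def lowIdx {d : ℕ} (i : Fin d) : Fin (2 * d) := ⟨i, by omega⟩

/-- The index of the coordinate `y_{d+i}`. -/
def highIdx {d : ℕ} (i : Fin d) : Fin (2 * d) := ⟨d + i, by omega⟩

/-- The canonical form `ω₀ = ∑ dy_i ∧ dy_{d+i}` as an alternating bilinear form. -/
def canonicalForm (d : ℕ) : (EuclideanSpace ℝ (Fin (2 * d))) [⋀^Fin 2]→L[ℝ] ℝ where
  toFun v := ∑ i : Fin d, (v 0 (lowIdx i) * v 1 (highIdx i) - v 1 (lowIdx i) * v 0 (highIdx i))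
  map_update_add' v j x y := by
    fin_cases j <;> simp [-Finset.sum_sub_distrib, ← Finset.sum_add_distrib] <;>
      exact Finset.sum_congr rfl fun i _ => by ring
  map_update_smul' v j r x := by
    fin_cases j <;> simp [-Finset.sum_sub_distrib, Finset.mul_sum] <;>
      exact Finset.sum_congr rfl fun i _ => by ring
  cont := by fun_prop
  map_eq_zero_of_eq' v i j h hij := by
    have h01 : v 0 = v 1 := by
      fin_cases i <;> fin_cases j <;> simp_all
    simp [h01, mul_comm]

/-- The canonical symplectic form of `ℝ^{2d}` as a (constant) 2-form on the manifold `ℝ^{2d}`. -/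
def ω₀ (d : ℕ) : TwoForm (𝓡 (2 * d)) (EuclideanSpace ℝ (Fin (2 * d))) :=
  fun _ => canonicalForm d

/-- The Hamiltonian `H₀ (y) = y_{d+1}`. -/
def H₀ (d : ℕ) [NeZero d] (y : EuclideanSpace ℝ (Fin (2 * d))) : ℝ := y (highIdx 0)

/-- The constant vector field `∂/∂y_1`, as a vector of `ℝ^{2d}`. -/
def partialOne (d : ℕ) [NeZero d] : EuclideanSpace ℝ (Fin (2 * d)) :=
  EuclideanSpace.single (lowIdx 0) 1

/-- `g` is a `C^k` symplectomorphism from the open set `g.source` of `(M, ω)` onto the open set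
`g.target` of `(ℝ^{2d}, ω₀)`: a `C^k` map with `C^k` inverse and `g^* ω₀ = ω`. -/
structure IsLocalSymplectomorphism {d : ℕ} {n : WithTop ℕ∞} {M : Type*} [TopologicalSpace M]
    [ChartedSpace (EuclideanSpace ℝ (Fin (2 * d))) M] (ω : SymplecticForm d n M)
    (k : WithTop ℕ∞) (g : OpenPartialHomeomorph M (EuclideanSpace ℝ (Fin (2 * d)))) : Prop where
  contMDiffOn : ContMDiffOn (𝓡 (2 * d)) (𝓡 (2 * d)) k g g.source
  contMDiffOn_symm : ContMDiffOn (𝓡 (2 * d)) (𝓡 (2 * d)) k g.symm g.target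
  pullback_eq : ∀ m ∈ g.source, pullback (𝓡 (2 * d)) (𝓡 (2 * d)) g (ω₀ d) m = ω.form m

end SymplecticFlowbox

end

open scoped Manifold

noncomputable section

open Filter Topology

/-! The theorem is Carathéodory's form of Darboux's theorem, proved by induction on `d` with the
regularity class `k = s - 1` fixed. In a chart, choose a linear function `G` with `G = ω(e, ·)` at
`x` and `dH(e) = 1`, and let `Y` be its Hamiltonian field. Then `f = dH(Y)` equals 1 at `x`, and `K
= Y / f` satisfies `dH(K) = 1` and `dG(K) = 0`. The level set `N = {H = H(x), G = G(x)}` has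
codimension two and is symplectic near `x`, so by induction it has Darboux coordinates.

Flow `N` out along `K` for time `t`, then along `X_H` for time `r`. The field `K` need not be
Hamiltonian, but `ω(K, ·) = dG / f` has differential `d(1/f) ∧ dG`, which vanishes on the level set
of `G` containing the first flow-out. Hence the pull-back of `ω` stays constant in `t`, while `H`
grows like `t`. Since `ω(X_H, ·) = dH` is closed, the second flow-out adds exactly the term `dr ∧
dt`, and `∂/∂r` is sent to `X_H`. So `r` and `t + H(x)` become the conjugate coordinates `y_1` and
`y_{d+1}` (`exists_flowbox_of_darboux`). Darboux's theorem in dimension `2d` is the case of a linear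
`H` (`darbouxStatement`).

No further derivative is lost. `N` has a `C^(k+1)` parametrization because `G` is linear and `H` is
`C^(k+1)`, so `ω` restricts to a `C^k` form on it; and a `C^k` field has a jointly `C^k` flow
(`exists_local_flow`), obtained from the inverse function theorem in a space of curves. For `k = 1`
the flow-outs are only `C^1`, so the Lie derivative of the pull-back (`hasDerivAt_pullback`) rests
on an interchange of derivatives for maps without second derivatives (`hasDerivAt_fderiv_apply`). -/

namespace SymplecticFlowbox

/-! ### Smoothness of composition operators on spaces of continuous maps -/

section Postcomp

universe u

variable {K : Type*} [TopologicalSpace K] [CompactSpace K]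
  {E G : Type u} [NormedAddCommGroup E] [NormedSpace ℝ E]
  [NormedAddCommGroup G] [NormedSpace ℝ G]

/-- Pointwise evaluation of a continuous family of continuous linear maps. -/
def pointwiseApply (K : Type*) [TopologicalSpace K] [CompactSpace K]
    (E G : Type u) [NormedAddCommGroup E] [NormedSpace ℝ E]
    [NormedAddCommGroup G] [NormedSpace ℝ G] :
    C(K, E →L[ℝ] G) →L[ℝ] C(K, E) →L[ℝ] C(K, G) :=
  LinearMap.mkContinuous₂
    (LinearMap.mk₂ ℝ (fun (A : C(K, E →L[ℝ] G)) (v : C(K, E)) =>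
        (⟨fun s => A s (v s), by fun_prop⟩ : C(K, G)))
      (fun _ _ _ => by ext; simp) (fun _ _ _ => by ext; simp)
      (fun _ _ _ => by ext; simp) (fun _ _ _ => by ext; simp)) 1
    (fun A v => by
      refine (ContinuousMap.norm_le _ (by positivity)).2 fun s => ?_
      have h1 := A.norm_coe_le_norm s
      have h2 := v.norm_coe_le_norm s
      calc ‖A s (v s)‖ ≤ ‖A s‖ * ‖v s‖ := (A s).le_opNorm _
        _ ≤ 1 * ‖A‖ * ‖v‖ := by rw [one_mul]; gcongr)

@[simp]
theorem pointwiseApply_apply (A : C(K, E →L[ℝ] G)) (v : C(K, E)) (s : K) :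
    pointwiseApply K E G A v s = A s (v s) := rfl

/-- The mean value inequality on the segments from `γ s` to `γ s + v s` gives a remainder uniform in
`s`: compactness of `K` makes `δ ↦ f' ∘ δ` continuous for the sup norm, so `f'` varies by less than
`c` on all these segments at once. -/
theorem hasFDerivAt_postcomp {f : E → G} {f' : E → E →L[ℝ] G} (hf : ∀ x, HasFDerivAt f (f' x) x)
    (hf' : Continuous f') (γ : C(K, E)) :
    HasFDerivAt
      (fun γ : C(K, E) =>
        (⟨f, continuous_iff_continuousAt.2 fun x => (hf x).continuousAt⟩ : C(E, G)).comp γ)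
      (pointwiseApply K E G ((⟨f', hf'⟩ : C(E, E →L[ℝ] G)).comp γ)) γ := by
  rw [hasFDerivAt_iff_isLittleO_nhds_zero, Asymptotics.isLittleO_iff]
  intro c hc
  have hcont : ContinuousAt (fun δ : C(K, E) => (⟨f', hf'⟩ : C(E, E →L[ℝ] G)).comp δ) γ :=
    (ContinuousMap.continuous_postcomp _).continuousAt
  have hnear : ∀ᶠ δ : C(K, E) in 𝓝 γ, dist ((⟨f', hf'⟩ : C(E, E →L[ℝ] G)).comp δ)
      ((⟨f', hf'⟩ : C(E, E →L[ℝ] G)).comp γ) < c :=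
    hcont.eventually (Metric.ball_mem_nhds ((⟨f', hf'⟩ : C(E, E →L[ℝ] G)).comp γ) hc)
  obtain ⟨r, hr, hball⟩ := Metric.eventually_nhds_iff.1 hnear
  filter_upwards [Metric.ball_mem_nhds (0 : C(K, E)) hr] with v hv
  rw [mem_ball_zero_iff] at hv
  refine (ContinuousMap.norm_le _ (by positivity)).2 fun s => ?_
  have key : ‖f (γ s + v s) - f (γ s) - f' (γ s) (γ s + v s - γ s)‖ ≤
      c * ‖γ s + v s - γ s‖ := by
    refine Convex.norm_image_sub_le_of_norm_hasFDerivWithin_le' (f' := f')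
      (s := segment ℝ (γ s) (γ s + v s)) (fun x _ => (hf x).hasFDerivWithinAt) ?_
      (convex_segment _ _) (left_mem_segment _ _ _) (right_mem_segment _ _ _)
    intro x hx
    rw [segment_eq_image'] at hx
    obtain ⟨θ, hθ, rfl⟩ := hx
    have hd : dist (γ + θ • v) γ < r := by
      rw [dist_eq_norm, add_sub_cancel_left, norm_smul, Real.norm_of_nonneg hθ.1]
      calc θ * ‖v‖ ≤ 1 * ‖v‖ := by gcongr; exact hθ.2
        _ < r := by rwa [one_mul]
    have h := (ContinuousMap.dist_apply_le_dist s).trans (hball hd).le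
    rw [dist_eq_norm] at h
    simpa using h
  calc _ = ‖f (γ s + v s) - f (γ s) - f' (γ s) (γ s + v s - γ s)‖ := by simp
    _ ≤ c * ‖γ s + v s - γ s‖ := key
    _ ≤ c * ‖v‖ := by
      rw [add_sub_cancel_left]; gcongr; exact v.norm_coe_le_norm s

/-- The derivative is again a composition operator, by `fderiv ℝ f`, followed by the continuous
linear `pointwiseApply`. The induction therefore changes the target `G` into `E →L[ℝ] G`, which is
why both spaces share a universe. -/
theorem contDiff_postcomp_nat (n : ℕ) {G : Type u} [NormedAddCommGroup G] [NormedSpace ℝ G]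
    (f : C(E, G)) (hf : ContDiff ℝ n f) :
    ContDiff ℝ n (fun γ : C(K, E) => f.comp γ) := by
  induction n generalizing G with
  | zero => simpa [contDiff_zero] using ContinuousMap.continuous_postcomp f
  | succ n ih =>
    have h1 := hf
    rw [Nat.cast_add, Nat.cast_one, contDiff_succ_iff_fderiv] at h1
    obtain ⟨hd, -, hc⟩ := h1
    rw [Nat.cast_add, Nat.cast_one, contDiff_succ_iff_hasFDerivAt]
    refine ⟨fun γ => pointwiseApply K E G ((⟨fderiv ℝ f, hc.continuous⟩ : C(E, E →L[ℝ] G)).comp γ),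
      ?_, fun γ => hasFDerivAt_postcomp (fun x => (hd x).hasFDerivAt) hc.continuous γ⟩
    exact (pointwiseApply K E G).contDiff.comp (ih ⟨fderiv ℝ f, hc.continuous⟩ hc)

theorem contDiff_postcomp {n : ℕ∞} (f : C(E, G)) (hf : ContDiff ℝ n f) :
    ContDiff ℝ n (fun γ : C(K, E) => f.comp γ) :=
  contDiff_iff_forall_nat_le.2 fun m hm =>
    contDiff_postcomp_nat m f (hf.of_le (by exact_mod_cast hm))

end Postcomp

/-! ### Smooth local flows of vector fields -/

section Flow

universe u

variable {F : Type u} [NormedAddCommGroup F] [NormedSpace ℝ F]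

/-- The primitive vanishing at `0` of a continuous curve on the unit interval. -/
def primitive (F : Type u) [NormedAddCommGroup F] [NormedSpace ℝ F] :
    C(unitInterval, F) →L[ℝ] C(unitInterval, F) :=
  LinearMap.mkContinuous
    { toFun := fun γ =>
        ⟨fun s => ∫ r in (0 : ℝ)..s, γ (Set.projIcc 0 1 zero_le_one r),
          (intervalIntegral.continuous_primitive
            (fun a b => (by fun_prop : Continuous fun r : ℝ =>
              γ (Set.projIcc 0 1 zero_le_one r)).intervalIntegrable a b) 0).comp
            continuous_subtype_val⟩
      map_add' := fun γ δ => by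
        ext s
        exact intervalIntegral.integral_add
          ((by fun_prop : Continuous fun r : ℝ =>
              γ (Set.projIcc 0 1 zero_le_one r)).intervalIntegrable _ _)
          ((by fun_prop : Continuous fun r : ℝ =>
              δ (Set.projIcc 0 1 zero_le_one r)).intervalIntegrable _ _)
      map_smul' := fun c γ => by
        ext s
        exact intervalIntegral.integral_smul c _ } 1
    (fun γ => by
      refine (ContinuousMap.norm_le _ (by positivity)).2 fun s => ?_
      refine (intervalIntegral.norm_integral_le_of_norm_le_const
        (C := ‖γ‖) fun r _ => γ.norm_coe_le_norm _).trans ?_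
      rw [sub_zero, abs_of_nonneg s.2.1, one_mul]
      exact mul_le_of_le_one_right (norm_nonneg _) s.2.2)

theorem primitive_apply (γ : C(unitInterval, F)) (s : unitInterval) :
    primitive F γ s = ∫ r in (0 : ℝ)..s, γ (Set.projIcc 0 1 zero_le_one r) := rfl

/-- The constant curves. -/
def constCurve (F : Type u) [NormedAddCommGroup F] [NormedSpace ℝ F] :
    F →L[ℝ] C(unitInterval, F) :=
  LinearMap.mkContinuous
    { toFun := fun x => ContinuousMap.const _ x
      map_add' := fun _ _ => rfl
      map_smul' := fun _ _ => rfl } 1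
    (fun x => by
      refine (ContinuousMap.norm_le _ (by positivity)).2 fun s => ?_
      rw [one_mul]
      exact le_refl ‖x‖)

@[simp]
theorem constCurve_apply (x : F) (s : unitInterval) : constCurve F x s = x := rfl

/-- The curve `r ↦ γ (s r)`. -/
def rescale (s : unitInterval) (γ : C(unitInterval, F)) : C(unitInterval, F) :=
  γ.comp ⟨fun r => s * r, by fun_prop⟩

omit [NormedSpace ℝ F] in
@[simp]
theorem rescale_apply (s r : unitInterval) (γ : C(unitInterval, F)) :
    rescale s γ r = γ (s * r) := rfl

/-- Consequence for the autonomous equation: if `γ` solves it with time parameter `τ`, then `r ↦ γ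
(s r)` solves it with parameter `s τ`. -/
theorem rescale_primitive (s : unitInterval) (γ : C(unitInterval, F)) :
    rescale s (primitive F γ) = (s : ℝ) • primitive F (rescale s γ) := by
  ext r
  simp only [rescale_apply, primitive_apply, ContinuousMap.smul_apply]
  have h : ∀ x ∈ Set.uIcc (0 : ℝ) r,
      γ (s * Set.projIcc 0 1 zero_le_one x) = γ (Set.projIcc 0 1 zero_le_one ((s : ℝ) * x)) := by
    intro x hx
    rw [Set.uIcc_of_le r.2.1] at hx
    have hx1 : x ∈ Set.Icc (0 : ℝ) 1 := ⟨hx.1, hx.2.trans r.2.2⟩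
    have hs : (s : ℝ) * x ∈ Set.Icc (0 : ℝ) 1 :=
      ⟨mul_nonneg s.2.1 hx.1, mul_le_one₀ s.2.2 hx.1 hx1.2⟩
    rw [Set.projIcc_of_mem _ hx1, Set.projIcc_of_mem _ hs]
    rfl
  rw [intervalIntegral.integral_congr h]
  have := intervalIntegral.smul_integral_comp_mul_left
    (a := 0) (b := (r : ℝ)) (fun x => γ (Set.projIcc 0 1 zero_le_one x)) (s : ℝ)
  rw [this]
  simp

theorem dist_rescale_le (s : unitInterval) (γ : C(unitInterval, F)) (x : F) :
    dist (rescale s γ) (constCurve F x) ≤ dist γ (constCurve F x) :=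
  (ContinuousMap.dist_le dist_nonneg).2 fun r =>
    ContinuousMap.dist_apply_le_dist (f := γ) (g := constCurve F x) (s * r)

/-- The integral equation `γ = x + τ ∫ X ∘ γ`, as a map with parameters `(τ, x)`. -/
def integralMap (X : C(F, F)) (p : (ℝ × F) × C(unitInterval, F)) :
    (ℝ × F) × C(unitInterval, F) :=
  (p.1, p.2 - constCurve F p.1.2 - p.1.1 • primitive F (X.comp p.2))

theorem contDiff_integralMap {k : ℕ∞} (X : C(F, F)) (hX : ContDiff ℝ k X) :
    ContDiff ℝ k (integralMap X) := by
  have h := contDiff_postcomp (K := unitInterval) X hX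
  have h2 : ContDiff ℝ k fun p : (ℝ × F) × C(unitInterval, F) => primitive F (X.comp p.2) :=
    (primitive F).contDiff.comp (h.comp contDiff_snd)
  have h3 : ContDiff ℝ k fun p : (ℝ × F) × C(unitInterval, F) => constCurve F p.1.2 :=
    (constCurve F).contDiff.comp (contDiff_snd.comp contDiff_fst)
  exact contDiff_fst.prodMk ((contDiff_snd.sub h3).sub
    ((contDiff_fst.comp contDiff_fst).smul h2))

/-- The shear `(q, v) ↦ (q, v + B q)`. -/
def shear {P Q : Type*} [NormedAddCommGroup P] [NormedSpace ℝ P] [NormedAddCommGroup Q]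
    [NormedSpace ℝ Q] (B : P →L[ℝ] Q) : (P × Q) ≃L[ℝ] (P × Q) :=
  ContinuousLinearEquiv.equivOfInverse
    ((ContinuousLinearMap.fst ℝ P Q).prod
      (ContinuousLinearMap.snd ℝ P Q + B.comp (ContinuousLinearMap.fst ℝ P Q)))
    ((ContinuousLinearMap.fst ℝ P Q).prod
      (ContinuousLinearMap.snd ℝ P Q - B.comp (ContinuousLinearMap.fst ℝ P Q)))
    (fun _ => by simp) (fun _ => by simp)

/-- At `τ = 0` the nonlinear term contributes nothing in the direction of the curve, so the
derivative is a shear, invertible whatever `X` is. -/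
theorem exists_hasFDerivAt_integralMap (X : C(F, F)) (hX : ContDiff ℝ 1 X) (x₀ : F) :
    ∃ e : ((ℝ × F) × C(unitInterval, F)) ≃L[ℝ] ((ℝ × F) × C(unitInterval, F)),
      HasFDerivAt (integralMap X) (e : _ →L[ℝ] _) ((0, x₀), constCurve F x₀) := by
  set p₀ : (ℝ × F) × C(unitInterval, F) := ((0, x₀), constCurve F x₀)
  have h2 : Differentiable ℝ fun p : (ℝ × F) × C(unitInterval, F) => primitive F (X.comp p.2) :=
    ((primitive F).contDiff.comp ((contDiff_postcomp (n := 1) (K := unitInterval) X hX).comp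
      contDiff_snd)).differentiable one_ne_zero
  have h1 : HasFDerivAt (fun p : (ℝ × F) × C(unitInterval, F) => p.1.1)
      ((ContinuousLinearMap.fst ℝ ℝ F).comp (ContinuousLinearMap.fst ℝ _ _)) p₀ :=
    ((ContinuousLinearMap.fst ℝ ℝ F).comp
      (ContinuousLinearMap.fst ℝ (ℝ × F) C(unitInterval, F))).hasFDerivAt
  have h3 : HasFDerivAt (fun p : (ℝ × F) × C(unitInterval, F) => constCurve F p.1.2)
      ((constCurve F).comp ((ContinuousLinearMap.snd ℝ ℝ F).comp
        (ContinuousLinearMap.fst ℝ _ _))) p₀ :=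
    ((constCurve F).comp ((ContinuousLinearMap.snd ℝ ℝ F).comp
        (ContinuousLinearMap.fst ℝ (ℝ × F) C(unitInterval, F)))).hasFDerivAt
  have h := (hasFDerivAt_fst (p := p₀) (𝕜 := ℝ)).prodMk
    (((hasFDerivAt_snd (p := p₀) (𝕜 := ℝ)).sub h3).sub (h1.smul (h2 p₀).hasFDerivAt))
  refine ⟨shear (-((constCurve F).comp (ContinuousLinearMap.snd ℝ ℝ F)) -
    (ContinuousLinearMap.fst ℝ ℝ F).smulRight (primitive F (X.comp (constCurve F x₀)))), ?_⟩
  refine HasFDerivAt.congr_fderiv (f := integralMap X) h ?_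
  apply ContinuousLinearMap.ext
  intro v
  refine Prod.ext ?_ ?_
  · rfl
  · simp [shear, p₀, ContinuousLinearEquiv.equivOfInverse]
    abel

end Flow

/-! ### Existence and joint smoothness of local flows -/

section Flow

universe u

variable {F : Type u} [NormedAddCommGroup F] [NormedSpace ℝ F]

/-- The solutions of the integral equation depend smoothly on the parameters. -/
theorem exists_smooth_family_of_solutions [CompleteSpace F] {k : ℕ∞} (hk : k ≠ 0) (X : C(F, F))
    (hX : ContDiff ℝ k X) (x₀ : F) :
    ∃ Γ : ℝ × F → C(unitInterval, F), ∀ᶠ q in 𝓝 ((0 : ℝ), x₀), ContDiffAt ℝ k Γ q ∧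
      Γ q = constCurve F q.2 + q.1 • primitive F (X.comp (Γ q)) ∧
      ∀ s : unitInterval, rescale s (Γ q) = Γ (s * q.1, q.2) := by
  have hk' : (k : WithTop ℕ∞) ≠ 0 := by exact_mod_cast hk
  have h1k : (1 : WithTop ℕ∞) ≤ k := by exact_mod_cast Order.one_le_iff_ne_zero.2 hk
  set p₀ : (ℝ × F) × C(unitInterval, F) := ((0, x₀), constCurve F x₀)
  obtain ⟨e, he⟩ := exists_hasFDerivAt_integralMap X (hX.of_le h1k) x₀
  have hΨ := contDiff_integralMap X hX
  set g := hΨ.contDiffAt.toOpenPartialHomeomorph (integralMap X) he hk' with hg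
  have hgcoe : (g : _ → _) = integralMap X := rfl
  have hsrc : p₀ ∈ g.source := hΨ.contDiffAt.mem_toOpenPartialHomeomorph_source he hk'
  have hp₀ : integralMap X p₀ = ((0, x₀), 0) := by
    simp [integralMap, p₀]
  have htgt : ((0, x₀), 0) ∈ g.target := by
    have := g.map_source hsrc
    rwa [hgcoe, hp₀] at this
  have hsymm₀ : g.symm ((0, x₀), 0) = p₀ := by
    have := g.left_inv hsrc
    rwa [hgcoe, hp₀] at this
  set j : ℝ × F → (ℝ × F) × C(unitInterval, F) := fun q => (q, 0)
  have hj : ContDiff ℝ k j := contDiff_id.prodMk contDiff_const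
  set Γ : ℝ × F → C(unitInterval, F) := fun q => (g.symm (j q)).2 with hΓ
  have hc : ContinuousAt (fun q => g.symm (j q)) (0, x₀) :=
    ContinuousAt.comp (g := g.symm) (g.continuousAt_symm htgt) hj.continuous.continuousAt
  have hc' : Tendsto (fun q => g.symm (j q)) (𝓝 (0, x₀)) (𝓝 p₀) := by
    have := hc.tendsto
    rwa [show g.symm (j (0, x₀)) = p₀ from hsymm₀] at this
  have hT : ∀ᶠ q in 𝓝 ((0 : ℝ), x₀), j q ∈ g.target :=
    hj.continuous.continuousAt.eventually (g.open_target.mem_nhds htgt)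
  -- Invertible operators form an open set, so the inverse is `C^k` at all points near the base
  -- point and not only there.
  have hequiv : ∀ᶠ p in 𝓝 p₀,
      fderiv ℝ (integralMap X) p ∈ Set.range
        ((↑) : (((ℝ × F) × C(unitInterval, F)) ≃L[ℝ] ((ℝ × F) × C(unitInterval, F))) → _) := by
    refine (hΨ.continuous_fderiv hk').continuousAt.eventually ?_
    rw [he.fderiv]
    exact ContinuousLinearEquiv.nhds e
  obtain ⟨r, hr, hball⟩ := Metric.mem_nhds_iff.1 (g.open_source.mem_nhds hsrc)
  have hsolves : ∀ q, j q ∈ g.target → g.symm (j q) = (q, Γ q) ∧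
      Γ q = constCurve F q.2 + q.1 • primitive F (X.comp (Γ q)) := by
    intro q hq
    have h := g.right_inv hq
    rw [hgcoe] at h
    have h1 : (g.symm (j q)).1 = q := congrArg Prod.fst h
    have h2 := congrArg Prod.snd h
    simp only [integralMap, h1, j] at h2
    refine ⟨Prod.ext h1 rfl, ?_⟩
    rw [sub_sub, sub_eq_zero] at h2
    exact h2
  have hunique : ∀ q γ, (q, γ) ∈ g.source →
      γ = constCurve F q.2 + q.1 • primitive F (X.comp γ) → γ = Γ q := by
    intro q γ hs hγ
    have h := g.left_inv hs
    have h2 : g (q, γ) = j q := by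
      rw [hgcoe]
      refine Prod.ext rfl ?_
      change γ - constCurve F q.2 - q.1 • primitive F (X.comp γ) = 0
      rw [sub_sub, sub_eq_zero]
      exact hγ
    rw [h2] at h
    exact (congrArg Prod.snd h).symm
  refine ⟨Γ, ?_⟩
  filter_upwards [hT, hc'.eventually hequiv, hc'.eventually (Metric.ball_mem_nhds p₀ hr),
    Metric.ball_mem_nhds ((0 : ℝ), x₀) hr] with q hq1 hq2 hq3 hq4
  obtain ⟨hq5, hq6⟩ := hsolves q hq1
  refine ⟨?_, hq6, fun s => ?_⟩
  · obtain ⟨e', he'⟩ := hq2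
    have hs : ContDiffAt ℝ k g.symm (j q) :=
      g.contDiffAt_symm hq1 (f₀' := e')
        (by rw [he']; exact (hΨ.differentiable hk' _).hasFDerivAt) hΨ.contDiffAt
    exact contDiffAt_snd.comp q (hs.comp q hj.contDiffAt)
  -- Rescaling brings the curve no further from the constant curve and the time no further from `0`,
  -- so the rescaled solution stays where the integral map is injective.
  · refine hunique _ _ (hball ?_) ?_
    · rw [hq5] at hq3
      simp only [p₀, Metric.mem_ball, Prod.dist_eq, max_lt_iff] at hq3 hq4 ⊢
      refine ⟨⟨?_, hq4.2⟩, (dist_rescale_le s _ _).trans_lt hq3.2⟩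
      refine lt_of_le_of_lt ?_ hq4.1
      rw [dist_zero_right, dist_zero_right, norm_mul, Real.norm_of_nonneg s.2.1]
      exact mul_le_of_le_one_left (norm_nonneg _) s.2.2
    · conv_lhs => rw [hq6]
      have h1 : rescale s (constCurve F q.2 + q.1 • primitive F (X.comp (Γ q))) =
          constCurve F q.2 + q.1 • rescale s (primitive F (X.comp (Γ q))) := rfl
      have h2 : rescale s (X.comp (Γ q)) = X.comp (rescale s (Γ q)) := rfl
      rw [h1, rescale_primitive, h2, smul_smul, mul_comm]

/-- The flow is the endpoint `Γ q 1`. By rescaling, `φ (s t, x)` is the value at `s` of the solution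
with parameters `(t, x)`, which turns the integral equation into the differential equation. -/
theorem exists_local_flow_of_contDiff [CompleteSpace F] {k : ℕ∞} (hk : k ≠ 0) (X : C(F, F))
    (hX : ContDiff ℝ k X) (x₀ : F) :
    ∃ φ : ℝ × F → F, (∀ᶠ q in 𝓝 ((0 : ℝ), x₀), ContDiffAt ℝ k φ q ∧
      fderiv ℝ φ q (1, 0) = X (φ q)) ∧ ∀ᶠ x in 𝓝 x₀, φ (0, x) = x := by
  have hk' : (k : WithTop ℕ∞) ≠ 0 := by exact_mod_cast hk
  have h1k : (1 : WithTop ℕ∞) ≤ k := by exact_mod_cast Order.one_le_iff_ne_zero.2 hk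
  obtain ⟨Γ, hΓ⟩ := exists_smooth_family_of_solutions hk X hX x₀
  let ev : C(unitInterval, F) →L[ℝ] F := ContinuousMap.evalCLM ℝ (1 : unitInterval)
  have hsm : ∀ᶠ q in 𝓝 ((0 : ℝ), x₀), ContDiffAt ℝ k (fun q => Γ q 1) q := by
    filter_upwards [hΓ] with q hq
    exact ev.contDiff.contDiffAt.comp q hq.1
  set φ : ℝ × F → F := fun q => Γ q 1 with hφ
  have hne : ∀ᶠ q in 𝓝 ((0 : ℝ), x₀), q.1 ≠ 0 → fderiv ℝ φ q (1, 0) = X (φ q) := by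
    filter_upwards [hΓ, hsm] with q hq hφq hq0
    obtain ⟨-, heq, hres⟩ := hq
    have hval : ∀ s ∈ Set.Icc (0 : ℝ) 1, φ (s * q.1, q.2) =
        q.2 + q.1 • ∫ r in (0 : ℝ)..s, X (Γ q (Set.projIcc 0 1 zero_le_one r)) := by
      intro s hs
      have h1 := congrArg (fun γ : C(unitInterval, F) => γ 1) (hres ⟨s, hs⟩)
      have h2 := congrArg (fun γ : C(unitInterval, F) => γ ⟨s, hs⟩) heq
      simp only [rescale_apply, mul_one] at h1
      rw [hφ]
      simp only
      rw [← h1]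
      exact h2
    have hd1 : HasDerivAt (fun s : ℝ => q.2 + q.1 • ∫ r in (0 : ℝ)..s,
        X (Γ q (Set.projIcc 0 1 zero_le_one r))) (q.1 • X (φ q)) 1 := by
      have hcont : Continuous fun r : ℝ => X (Γ q (Set.projIcc 0 1 zero_le_one r)) := by fun_prop
      have := (((hcont.integral_hasStrictDerivAt 0 1).hasDerivAt).const_smul q.1).const_add q.2
      rwa [Set.projIcc_right] at this
    have hd2 : HasDerivAt (fun s : ℝ => φ (s * q.1, q.2)) (fderiv ℝ φ q (q.1, 0)) 1 := by
      have hin : HasDerivAt (fun s : ℝ => (s * q.1, q.2)) (q.1, (0 : F)) 1 := by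
        have := ((hasDerivAt_id (1 : ℝ)).mul_const q.1).prodMk (hasDerivAt_const (1 : ℝ) q.2)
        simpa using this
      have hφd : HasFDerivAt φ (fderiv ℝ φ q) ((fun s : ℝ => (s * q.1, q.2)) 1) := by
        simpa using (hφq.differentiableAt hk').hasFDerivAt
      exact hφd.comp_hasDerivAt 1 hin
    -- The two functions of `s` agree only on `[0, 1]`, so their derivatives at the endpoint `1` are
    -- compared from the left.
    have hu : UniqueDiffWithinAt ℝ (Set.Icc (0 : ℝ) 1) 1 :=
      uniqueDiffOn_Icc zero_lt_one 1 (by simp)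
    have := hu.eq_deriv _ (hd2.hasDerivWithinAt.congr (fun s hs => (hval s hs).symm)
      (hval 1 (by simp)).symm) hd1.hasDerivWithinAt
    have hlin : fderiv ℝ φ q (q.1, 0) = q.1 • fderiv ℝ φ q (1, 0) := by
      rw [← map_smul]; simp
    rw [hlin] at this
    exact smul_right_injective _ hq0 this
  refine ⟨φ, ?_, ?_⟩
  · filter_upwards [hsm, hne.eventually_nhds] with q hq1 hq2
    refine ⟨hq1, ?_⟩
    by_cases hq0 : q.1 = 0
    -- At time `0` rescaling gives no information; the equation passes to the limit from nonzero
    -- times.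
    · have hc1 : ContinuousAt (fun p => fderiv ℝ φ p (1, 0)) q :=
        ((hq1.fderiv_right (m := 0) (by simpa using h1k)).continuousAt).clm_apply
          continuousAt_const
      have hc2 : ContinuousAt (fun p => X (φ p)) q :=
        X.continuous.continuousAt.comp hq1.continuousAt
      have hl : Tendsto (fun t : ℝ => ((t, q.2) : ℝ × F)) (𝓝[≠] 0) (𝓝 q) := by
        have : ContinuousAt (fun t : ℝ => ((t, q.2) : ℝ × F)) 0 := by fun_prop
        have h := this.tendsto
        rw [show ((0 : ℝ), q.2) = q from Prod.ext hq0.symm rfl] at h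
        exact h.mono_left nhdsWithin_le_nhds
      refine tendsto_nhds_unique (hc1.tendsto.comp hl) ((hc2.tendsto.comp hl).congr' ?_)
      filter_upwards [hl.eventually hq2, self_mem_nhdsWithin] with t ht ht0
      exact (ht ht0).symm
    · exact hq2.self_of_nhds hq0
  · have hin : Tendsto (fun x : F => ((0 : ℝ), x)) (𝓝 x₀) (𝓝 (0, x₀)) :=
      (by fun_prop : Continuous fun x : F => ((0 : ℝ), x)).tendsto x₀
    filter_upwards [hin.eventually hΓ] with x hx
    have := congrArg (fun γ : C(unitInterval, F) => γ 1) hx.2.1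
    simpa using this

/-- **Smooth local flows**: a vector field of class `C^k`, `k ≥ 1`, has a local flow which is
jointly of class `C^k` in time and initial condition. -/
theorem exists_local_flow [FiniteDimensional ℝ F] {k : ℕ∞} (hk : k ≠ 0) {X : F → F} {x₀ : F}
    (hX : ∀ᶠ x in 𝓝 x₀, ContDiffAt ℝ k X x) :
    ∃ φ : ℝ × F → F, (∀ᶠ q in 𝓝 ((0 : ℝ), x₀), ContDiffAt ℝ k φ q ∧
      fderiv ℝ φ q (1, 0) = X (φ q)) ∧ ∀ᶠ x in 𝓝 x₀, φ (0, x) = x := by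
  have : CompleteSpace F := FiniteDimensional.complete ℝ F
  obtain ⟨r, hr, hball⟩ := Metric.eventually_nhds_iff_ball.1 hX
  -- The cut-off makes the field globally `C^k` and leaves it unchanged near `x₀`, where the flow
  -- stays for small times.
  let χ : ContDiffBump x₀ := ⟨r / 4, r / 2, by positivity, by linarith⟩
  have hY : ContDiff ℝ k fun x => χ x • X x := by
    rw [contDiff_iff_contDiffAt]
    intro x
    by_cases hx : x ∈ Metric.ball x₀ r
    · exact χ.contDiffAt.smul (hball x hx)
    · have h0 : (fun x => χ x • X x) =ᶠ[𝓝 x] fun _ => 0 := by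
        have : ∀ᶠ y in 𝓝 x, y ∉ Metric.closedBall x₀ (r / 2) := by
          refine Metric.isClosed_closedBall.isOpen_compl.mem_nhds ?_
          simp only [Metric.mem_ball, not_lt, Set.mem_compl_iff, Metric.mem_closedBall,
            not_le] at hx ⊢
          linarith
        filter_upwards [this] with y hy
        rw [χ.zero_of_le_dist, zero_smul]
        exact (not_le.1 hy).le
      exact contDiffAt_const.congr_of_eventuallyEq h0
  obtain ⟨φ, h1, h2⟩ := exists_local_flow_of_contDiff hk ⟨_, hY.continuous⟩ hY x₀
  refine ⟨φ, ?_, h2⟩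
  have hφ₀ : Tendsto φ (𝓝 (0, x₀)) (𝓝 x₀) := by
    have := h1.self_of_nhds.1.continuousAt.tendsto
    rwa [h2.self_of_nhds] at this
  filter_upwards [h1, hφ₀.eventually χ.eventuallyEq_one] with q hq1 hq2
  refine ⟨hq1.1, hq1.2.trans ?_⟩
  change χ (φ q) • X (φ q) = X (φ q)
  rw [hq2, Pi.one_apply, one_smul]

end Flow

/-! ### Transport of closed 2-forms by flows -/

section Transport

variable {E F : Type*} [NormedAddCommGroup E] [NormedSpace ℝ E]
  [NormedAddCommGroup F] [NormedSpace ℝ F]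

/-- Exchange of a partial derivative with a directional derivative, for maps which are merely
differentiable, when the partial derivative is strictly differentiable. -/
theorem hasDerivAt_fderiv_apply {φ Y : E → F} {q e : E} {Y' : E →L[ℝ] F}
    (hφ : ∀ᶠ p in 𝓝 q, DifferentiableAt ℝ φ p ∧ fderiv ℝ φ p e = Y p)
    (hY : HasStrictFDerivAt Y Y' q) (w : E) :
    HasDerivAt (fun s : ℝ => fderiv ℝ φ (q + s • e) w) (Y' w) 0 := by
  rw [hasDerivAt_iff_isLittleO_nhds_zero, Asymptotics.isLittleO_iff]
  intro c hc
  obtain ⟨c', hc', hcc⟩ : ∃ c' : ℝ, 0 < c' ∧ c' * ‖w‖ ≤ c := by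
    refine ⟨c / (‖w‖ + 1), by positivity, ?_⟩
    rw [div_mul_eq_mul_div, div_le_iff₀ (by positivity)]
    nlinarith [norm_nonneg w]
  have hst : ∀ᶠ p : E × E in 𝓝 (q, q), ‖Y p.1 - Y p.2 - Y' (p.1 - p.2)‖ ≤ c' * ‖p.1 - p.2‖ :=
    hY.isLittleO.def hc'
  have hline : ContinuousAt (fun s : ℝ × ℝ => q + s.1 • e + s.2 • w) (0, 0) := by fun_prop
  have hline' : Tendsto (fun s : ℝ × ℝ => q + s.1 • e + s.2 • w) (𝓝 (0, 0)) (𝓝 q) := by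
    simpa using hline.tendsto
  have hline2 : Tendsto (fun s : ℝ × ℝ => (q + s.1 • e + s.2 • w, q + s.1 • e))
      (𝓝 (0, 0)) (𝓝 (q, q)) := by
    refine hline'.prodMk_nhds ?_
    have : ContinuousAt (fun s : ℝ × ℝ => q + s.1 • e) (0, 0) := by fun_prop
    simpa using this.tendsto
  have hev : ∀ᶠ s : ℝ × ℝ in 𝓝 (0, 0),
      (DifferentiableAt ℝ φ (q + s.1 • e + s.2 • w) ∧
        fderiv ℝ φ (q + s.1 • e + s.2 • w) e = Y (q + s.1 • e + s.2 • w)) ∧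
      (DifferentiableAt ℝ φ (q + s.1 • e) ∧ fderiv ℝ φ (q + s.1 • e) e = Y (q + s.1 • e)) ∧
      ‖Y (q + s.1 • e + s.2 • w) - Y (q + s.1 • e) - Y' (s.2 • w)‖ ≤ c' * ‖s.2 • w‖ := by
    have hb : Tendsto (fun s : ℝ × ℝ => q + s.1 • e) (𝓝 (0, 0)) (𝓝 q) :=
      (continuous_snd.tendsto (q, q)).comp hline2
    filter_upwards [hline'.eventually hφ, hb.eventually hφ, hline2.eventually hst] with s h1 h2 h3
    refine ⟨h1, h2, ?_⟩
    simpa using h3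
  obtain ⟨r, hr, hball⟩ := Metric.eventually_nhds_iff_ball.1 hev
  have hmem : ∀ s t : ℝ, |s| < r → |t| < r → (s, t) ∈ Metric.ball ((0 : ℝ), (0 : ℝ)) r := by
    intro s t hs ht
    rw [Metric.mem_ball, Prod.dist_eq]
    simp [hs, ht]
  have hγ : ∀ (s : ℝ) (z : E), HasDerivAt (fun s : ℝ => q + s • e + z) e s := by
    intro s z
    simpa using (((hasDerivAt_id s).smul_const e).const_add q).add_const z
  filter_upwards [Metric.ball_mem_nhds (0 : ℝ) hr] with s hs
  rw [Metric.mem_ball, dist_zero_right, Real.norm_eq_abs] at hs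
  simp only [zero_add, zero_smul, add_zero]
  have hd0 : DifferentiableAt ℝ φ q := by
    simpa using (hball (0, 0) (hmem 0 0 (by simpa) (by simpa))).2.1.1
  have hds : DifferentiableAt ℝ φ (q + s • e) := (hball (s, 0) (hmem s 0 hs (by simpa))).2.1.1
  have hw : ∀ z : E, HasDerivAt (fun t : ℝ => z + t • w) w 0 := fun z => by
    simpa using ((hasDerivAt_id (0 : ℝ)).smul_const w).const_add z
  -- The error to be bounded is the `t`-derivative at `0` of this second difference. A Lipschitz
  -- bound in `t` suffices; it comes from the mean value inequality in `s`, whose derivative is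
  -- controlled by strict differentiability of `Y`.
  have hdiff : HasDerivAt (fun t : ℝ => φ (q + s • e + t • w) - φ (q + t • w) - s • t • Y' w)
      (fderiv ℝ φ (q + s • e) w - fderiv ℝ φ q w - s • Y' w) 0 := by
    refine ((HasFDerivAt.comp_hasDerivAt (0 : ℝ) ?_ (hw _)).sub
      (HasFDerivAt.comp_hasDerivAt (0 : ℝ) ?_ (hw _))).sub ?_
    · simpa using hds.hasFDerivAt
    · simpa using hd0.hasFDerivAt
    · have := ((hasDerivAt_id (0 : ℝ)).smul_const (Y' w)).const_smul s
      rwa [one_smul] at this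
  have hle := hdiff.le_of_lip' (C := c * ‖s‖) (by positivity) ?_
  · exact hle
  filter_upwards [Metric.ball_mem_nhds (0 : ℝ) hr] with t ht
  rw [Metric.mem_ball, dist_zero_right, Real.norm_eq_abs] at ht
  have hmv : ‖(φ (q + s • e + t • w) - φ (q + s • e + 0) - s • t • Y' w) -
      (φ (q + (0 : ℝ) • e + t • w) - φ (q + (0 : ℝ) • e + 0) - (0 : ℝ) • t • Y' w)‖ ≤
      c' * ‖t • w‖ * ‖s - 0‖ := by
    refine (convex_uIcc (0 : ℝ) s).norm_image_sub_le_of_norm_hasDerivWithin_le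
      (f := fun s : ℝ => φ (q + s • e + t • w) - φ (q + s • e + 0) - s • t • Y' w)
      (f' := fun s => Y (q + s • e + t • w) - Y (q + s • e) - t • Y' w)
      ?_ ?_ Set.left_mem_uIcc Set.right_mem_uIcc
    · intro σ hσ
      have hσ' : |σ| < r :=
        (by simpa using Set.abs_sub_left_of_mem_uIcc hσ : |σ| ≤ |s|).trans_lt hs
      obtain ⟨h1, h2, -⟩ := hball _ (hmem σ t hσ' ht)
      refine HasDerivAt.hasDerivWithinAt (HasDerivAt.sub (HasDerivAt.sub ?_ ?_) ?_)
      · have := h1.1.hasFDerivAt.comp_hasDerivAt σ (hγ σ (t • w))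
        rwa [h1.2] at this
      · have h2' : HasFDerivAt φ (fderiv ℝ φ (q + σ • e)) (q + σ • e + 0) := by
          simpa using h2.1.hasFDerivAt
        have := h2'.comp_hasDerivAt σ (hγ σ 0)
        rwa [h2.2] at this
      · simpa using (hasDerivAt_id σ).smul_const (t • Y' w)
    · intro σ hσ
      have hσ' : |σ| < r :=
        (by simpa using Set.abs_sub_left_of_mem_uIcc hσ : |σ| ≤ |s|).trans_lt hs
      simpa using (hball _ (hmem σ t hσ' ht)).2.2
  calc _ = ‖(φ (q + s • e + t • w) - φ (q + s • e + 0) - s • t • Y' w) -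
      (φ (q + (0 : ℝ) • e + t • w) - φ (q + (0 : ℝ) • e + 0) - (0 : ℝ) • t • Y' w)‖ := by
        congr 1
        simp only [zero_smul, add_zero, smul_zero, sub_zero]
        abel
    _ ≤ c' * ‖t • w‖ * ‖s - 0‖ := hmv
    _ = (c' * ‖w‖) * ‖s‖ * ‖t - 0‖ := by rw [norm_smul, sub_zero, sub_zero]; ring
    _ ≤ c * ‖s‖ * ‖t - 0‖ := by gcongr

end Transport

/-! ### Cartan's formula and flow-outs -/

section Transport

variable {E F P : Type*} [NormedAddCommGroup E] [NormedSpace ℝ E]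
  [NormedAddCommGroup F] [NormedSpace ℝ F] [NormedAddCommGroup P] [NormedSpace ℝ P]

/-- Closedness at a point of a 2-form, written as a field of bilinear forms. -/
def IsClosedAt (B : F → F →L[ℝ] F →L[ℝ] ℝ) (x : F) : Prop :=
  ∀ u v w : F, fderiv ℝ B x u v w + fderiv ℝ B x v w u + fderiv ℝ B x w u v = 0

theorem antisymm_of_alternating {b : F →L[ℝ] F →L[ℝ] ℝ} (hb : ∀ u, b u u = 0) (u v : F) :
    b u v = -b v u := by
  have h := hb (u + v)
  simp only [map_add, add_apply, hb] at h
  linarith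

theorem fderiv_antisymm {B : F → F →L[ℝ] F →L[ℝ] ℝ} (halt : ∀ x u, B x u u = 0) {x : F}
    (hB : DifferentiableAt ℝ B x) (w u v : F) :
    fderiv ℝ B x w u v = -fderiv ℝ B x w v u := by
  have h : ∀ u v, fderiv ℝ (fun x => B x u v) x w = fderiv ℝ B x w u v := by
    intro u v
    have h1 := (hB.hasFDerivAt.clm_apply (hasFDerivAt_const u x)).clm_apply
      (hasFDerivAt_const v x)
    rw [h1.fderiv]
    simp
  rw [← h u v, ← h v u, ← neg_apply, ← fderiv_fun_neg]
  congr 2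
  exact funext fun x => antisymm_of_alternating (halt x) u v

/-- Cartan's formula along a flow: the derivative of the coefficients of the pull-back of a closed
form `B` is given by the exterior derivative of the contraction of `B` with the field. -/
theorem hasDerivAt_pullback {B : F → F →L[ℝ] F →L[ℝ] ℝ} {X : F → F} {Φ : E → F} {q e : E}
    (halt : ∀ x u, B x u u = 0) (hΦ : ∀ᶠ p in 𝓝 q, DifferentiableAt ℝ Φ p ∧
      fderiv ℝ Φ p e = X (Φ p)) (hΦq : ContDiffAt ℝ 1 Φ q)
    (hX : ContDiffAt ℝ 1 X (Φ q)) (hB : DifferentiableAt ℝ B (Φ q))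
    (hcl : IsClosedAt B (Φ q)) (w w' : E) :
    HasDerivAt
      (fun s : ℝ => B (Φ (q + s • e)) (fderiv ℝ Φ (q + s • e) w) (fderiv ℝ Φ (q + s • e) w'))
      (fderiv ℝ (fun x => B x (X x)) (Φ q) (fderiv ℝ Φ q w) (fderiv ℝ Φ q w') -
        fderiv ℝ (fun x => B x (X x)) (Φ q) (fderiv ℝ Φ q w') (fderiv ℝ Φ q w)) 0 := by
  have hXd : HasFDerivAt X (fderiv ℝ X (Φ q)) (Φ q) :=
    (hX.differentiableAt one_ne_zero).hasFDerivAt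
  have hY : HasStrictFDerivAt (fun p => X (Φ p)) ((fderiv ℝ X (Φ q)).comp (fderiv ℝ Φ q)) q :=
    (hX.hasStrictFDerivAt one_ne_zero).comp q (hΦq.hasStrictFDerivAt one_ne_zero)
  have hline : HasDerivAt (fun s : ℝ => q + s • e) e 0 := by
    simpa using ((hasDerivAt_id (0 : ℝ)).smul_const e).const_add q
  have hΦ0 : HasFDerivAt Φ (fderiv ℝ Φ q) (q + (0 : ℝ) • e) := by
    simpa using (hΦq.differentiableAt one_ne_zero).hasFDerivAt
  have hΦl : HasDerivAt (fun s : ℝ => Φ (q + s • e)) (X (Φ q)) 0 := by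
    have := hΦ0.comp_hasDerivAt 0 hline
    rwa [hΦ.self_of_nhds.2] at this
  have hB0 : HasFDerivAt B (fderiv ℝ B (Φ q)) (Φ (q + (0 : ℝ) • e)) := by
    simpa using hB.hasFDerivAt
  have hBl : HasDerivAt (fun s : ℝ => B (Φ (q + s • e))) (fderiv ℝ B (Φ q) (X (Φ q))) 0 :=
    HasFDerivAt.comp_hasDerivAt (E := F →L[ℝ] F →L[ℝ] ℝ) (0 : ℝ) hB0 hΦl
  have h := (hBl.clm_apply (hasDerivAt_fderiv_apply hΦ hY w)).clm_apply
    (hasDerivAt_fderiv_apply hΦ hY w')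
  have hα : fderiv ℝ (fun x => B x (X x)) (Φ q) =
      ((B (Φ q)).comp (fderiv ℝ X (Φ q))) + (fderiv ℝ B (Φ q)).flip (X (Φ q)) :=
    (hB.hasFDerivAt.clm_apply hXd).fderiv
  refine h.congr_deriv ?_
  rw [hα]
  simp only [zero_smul, add_zero, add_apply,
    ContinuousLinearMap.comp_apply, ContinuousLinearMap.flip_apply]
  set a := fderiv ℝ Φ q w
  set b := fderiv ℝ Φ q w'
  -- Closedness trades the derivative of `B` along `X` for derivatives along `a` and `b`;
  -- antisymmetry matches the rest.
  have h1 := hcl (X (Φ q)) a b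
  have h2 := fderiv_antisymm halt hB a b (X (Φ q))
  have h3 := antisymm_of_alternating (halt (Φ q)) a (fderiv ℝ X (Φ q) b)
  linarith

/-- A function with vanishing time derivative near `(0, p₀)` is locally independent of time. -/
theorem eventually_eq_of_hasDerivAt_zero {ι : Type*} {c : ι → ℝ × P → ℝ} {p₀ : P}
    (h : ∀ᶠ q in 𝓝 ((0 : ℝ), p₀), ∀ i,
      HasDerivAt (fun s : ℝ => c i (q + s • ((1 : ℝ), (0 : P)))) 0 0) :
    ∀ᶠ q in 𝓝 ((0 : ℝ), p₀), ∀ i, c i q = c i (0, q.2) := by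
  obtain ⟨r, hr, hball⟩ := Metric.eventually_nhds_iff_ball.1 h
  filter_upwards [Metric.ball_mem_nhds _ hr] with q hq i
  rw [Metric.mem_ball, Prod.dist_eq, max_lt_iff, dist_zero_right, Real.norm_eq_abs] at hq
  have hd : ∀ t ∈ Set.uIcc (0 : ℝ) q.1,
      HasDerivWithinAt (fun t : ℝ => c i (t, q.2)) 0 (Set.uIcc (0 : ℝ) q.1) t := by
    intro t ht
    have ht' : |t| < r :=
      (by simpa using Set.abs_sub_left_of_mem_uIcc ht : |t| ≤ |q.1|).trans_lt hq.1
    have hmem : (t, q.2) ∈ Metric.ball ((0 : ℝ), p₀) r := by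
      rw [Metric.mem_ball, Prod.dist_eq, max_lt_iff, dist_zero_right, Real.norm_eq_abs]
      exact ⟨ht', hq.2⟩
    have h1 := hball _ hmem i
    have h2 : HasDerivAt (fun s : ℝ => s - t) 1 t := (hasDerivAt_id t).sub_const t
    have h1' : HasDerivAt (fun s : ℝ => c i ((t, q.2) + s • ((1 : ℝ), (0 : P)))) 0 (t - t) := by
      rwa [sub_self]
    have h3 := HasDerivAt.scomp (h := fun s : ℝ => s - t) t h1' h2
    simpa [Function.comp_def] using h3.hasDerivWithinAt
  have := (convex_uIcc (0 : ℝ) q.1).norm_image_sub_le_of_norm_hasDerivWithin_le (C := 0) hd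
    (by simp) Set.left_mem_uIcc Set.right_mem_uIcc
  rw [zero_mul, norm_le_zero_iff, sub_eq_zero] at this
  exact this

/-- A 2-form, closed near `x₀`, of class `C^k` near `x₀` and nondegenerate at `x₀`, written as a
field of bilinear forms. -/
structure IsSymplecticNear (k : ℕ∞) (B : F → F →L[ℝ] F →L[ℝ] ℝ) (x₀ : F) : Prop where
  alternating : ∀ x u, B x u u = 0
  contDiffAt : ∀ᶠ x in 𝓝 x₀, ContDiffAt ℝ k B x
  closed : ∀ᶠ x in 𝓝 x₀, IsClosedAt B x
  nondegenerate : ∀ u, (∀ v, B x₀ u v = 0) → u = 0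

/-- `Φ (t, p)` is the value at time `t` of the integral curve of `X` starting from `ψ p`, for
`(t, p)` near `(0, p₀)`, and is of class `C^k`. -/
structure IsFlowout (k : ℕ∞) (X : F → F) (ψ : P → F) (p₀ : P) (Φ : ℝ × P → F) : Prop where
  contDiffAt : ∀ᶠ q in 𝓝 ((0 : ℝ), p₀), ContDiffAt ℝ k Φ q
  fderiv_time : ∀ᶠ q in 𝓝 ((0 : ℝ), p₀), fderiv ℝ Φ q (1, 0) = X (Φ q)
  initial : ∀ᶠ p in 𝓝 p₀, Φ (0, p) = ψ p

theorem exists_isFlowout [FiniteDimensional ℝ F] {k : ℕ∞} (hk : k ≠ 0) {X : F → F} {ψ : P → F}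
    {p₀ : P} (hX : ∀ᶠ x in 𝓝 (ψ p₀), ContDiffAt ℝ k X x)
    (hψ : ∀ᶠ p in 𝓝 p₀, ContDiffAt ℝ k ψ p) :
    ∃ Φ : ℝ × P → F, IsFlowout k X ψ p₀ Φ := by
  have hk' : (k : WithTop ℕ∞) ≠ 0 := by exact_mod_cast hk
  obtain ⟨φ, hφ, hφ0⟩ := exists_local_flow hk hX
  have hψc : ContinuousAt ψ p₀ := hψ.self_of_nhds.continuousAt
  have hj : Tendsto (fun q : ℝ × P => (q.1, ψ q.2)) (𝓝 (0, p₀)) (𝓝 (0, ψ p₀)) :=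
    (continuousAt_fst (p := ((0 : ℝ), p₀))).prodMk
      (ContinuousAt.comp (x := ((0 : ℝ), p₀)) hψc continuousAt_snd)
  have hψ2 : ∀ᶠ q in 𝓝 ((0 : ℝ), p₀), ContDiffAt ℝ k ψ q.2 :=
    (continuousAt_snd (p := ((0 : ℝ), p₀))).eventually hψ
  refine ⟨fun q => φ (q.1, ψ q.2), ?_, ?_, hψc.eventually hφ0⟩
  · filter_upwards [hj.eventually hφ, hψ2] with q hq hψq
    exact hq.1.comp q (contDiffAt_fst.prodMk (hψq.comp q contDiffAt_snd))
  · filter_upwards [hj.eventually hφ, hψ2] with q hq hψq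
    have h1 : HasFDerivAt (fun q : ℝ × P => (q.1, ψ q.2)) _ q :=
      (hasFDerivAt_fst (𝕜 := ℝ)).prodMk
        (((hψq.differentiableAt hk').hasFDerivAt).comp q hasFDerivAt_snd)
    have h2 := (hq.1.differentiableAt hk').hasFDerivAt.comp q h1
    have h3 : fderiv ℝ (fun q : ℝ × P => φ (q.1, ψ q.2)) q = _ := h2.fderiv
    rw [h3, ← hq.2]
    simp

namespace IsFlowout

variable {k : ℕ∞} {X : F → F} {ψ : P → F} {p₀ : P} {Φ : ℝ × P → F}

theorem tendsto (h : IsFlowout k X ψ p₀ Φ) : Tendsto Φ (𝓝 (0, p₀)) (𝓝 (ψ p₀)) := by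
  have := h.contDiffAt.self_of_nhds.continuousAt.tendsto
  rwa [h.initial.self_of_nhds] at this

theorem eventually_fderiv_initial (hk : k ≠ 0) (h : IsFlowout k X ψ p₀ Φ) :
    ∀ᶠ p in 𝓝 p₀, ∀ w : ℝ × P, fderiv ℝ Φ (0, p) w = w.1 • X (ψ p) + fderiv ℝ ψ p w.2 := by
  have hk' : (k : WithTop ℕ∞) ≠ 0 := by exact_mod_cast hk
  have hin : Tendsto (fun p : P => ((0 : ℝ), p)) (𝓝 p₀) (𝓝 (0, p₀)) :=
    (by fun_prop : Continuous fun p : P => ((0 : ℝ), p)).tendsto p₀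
  filter_upwards [hin.eventually h.contDiffAt, hin.eventually h.fderiv_time,
    h.initial.eventually_nhds] with p h1 h2 h3 w
  have h4 : HasFDerivAt (fun p : P => Φ (0, p))
      ((fderiv ℝ Φ (0, p)).comp (ContinuousLinearMap.inr ℝ ℝ P)) p :=
    (h1.differentiableAt hk').hasFDerivAt.comp p (hasFDerivAt_prodMk_right (0 : ℝ) p)
  have h5 : fderiv ℝ ψ p = _ := (h4.congr_of_eventuallyEq (h3.mono fun _ h => h.symm)).fderiv
  have hw : w = w.1 • ((1 : ℝ), (0 : P)) + (0, w.2) := by ext <;> simp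
  conv_lhs => rw [hw, map_add, map_smul, h2, h3.self_of_nhds]
  rw [h5]
  rfl

/-- The pull-back of a closed form by a flow-out, when the contraction of the form with the field
is closed along the flow-out. -/
theorem eventually_pullback_eq (hk : k ≠ 0) (h : IsFlowout k X ψ p₀ Φ)
    (hX : ∀ᶠ x in 𝓝 (ψ p₀), ContDiffAt ℝ k X x) {B : F → F →L[ℝ] F →L[ℝ] ℝ}
    (hB : IsSymplecticNear k B (ψ p₀))
    (hα : ∀ᶠ q in 𝓝 ((0 : ℝ), p₀), ∀ w w' : ℝ × P,
      fderiv ℝ (fun x => B x (X x)) (Φ q) (fderiv ℝ Φ q w) (fderiv ℝ Φ q w') =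
        fderiv ℝ (fun x => B x (X x)) (Φ q) (fderiv ℝ Φ q w') (fderiv ℝ Φ q w)) :
    ∀ᶠ q in 𝓝 ((0 : ℝ), p₀), ∀ w w' : ℝ × P,
      B (Φ q) (fderiv ℝ Φ q w) (fderiv ℝ Φ q w') =
        w.1 * B (ψ q.2) (X (ψ q.2)) (fderiv ℝ ψ q.2 w'.2) -
          w'.1 * B (ψ q.2) (X (ψ q.2)) (fderiv ℝ ψ q.2 w.2) +
          B (ψ q.2) (fderiv ℝ ψ q.2 w.2) (fderiv ℝ ψ q.2 w'.2) := by
  have hk' : (k : WithTop ℕ∞) ≠ 0 := by exact_mod_cast hk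
  have h1k : (1 : WithTop ℕ∞) ≤ k := by exact_mod_cast Order.one_le_iff_ne_zero.2 hk
  have hconst := eventually_eq_of_hasDerivAt_zero (p₀ := p₀)
    (c := fun (i : (ℝ × P) × (ℝ × P)) q => B (Φ q) (fderiv ℝ Φ q i.1) (fderiv ℝ Φ q i.2)) (by
      filter_upwards [h.contDiffAt.eventually_nhds, h.fderiv_time.eventually_nhds,
        h.tendsto.eventually hX, h.tendsto.eventually hB.contDiffAt,
        h.tendsto.eventually hB.closed, hα] with q h1 h2 h3 h4 h5 h6 i
      have := hasDerivAt_pullback hB.alternating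
        (h1.and h2 |>.mono fun p hp => ⟨hp.1.differentiableAt hk', hp.2⟩)
        (h1.self_of_nhds.of_le h1k) (h3.of_le h1k) (h4.differentiableAt hk') h5 i.1 i.2
      rwa [h6, sub_self] at this)
  have hsnd : Tendsto (fun q : ℝ × P => q.2) (𝓝 (0, p₀)) (𝓝 p₀) := continuousAt_snd
  filter_upwards [hconst, hsnd.eventually (h.eventually_fderiv_initial hk),
    hsnd.eventually h.initial] with q h1 h2 h3 w w'
  rw [h1 (w, w')]
  simp only [h2, h3, map_add, map_smul, add_apply,
    smul_apply, hB.alternating, smul_eq_mul]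
  rw [antisymm_of_alternating (hB.alternating _) (fderiv ℝ ψ q.2 w.2) (X (ψ q.2))]
  ring

/-- Evolution along a flow-out of a function whose derivative in the direction of the field is
constant. -/
theorem eventually_apply_eq (hk : k ≠ 0) (h : IsFlowout k X ψ p₀ Φ) {f : F → ℝ} {c : ℝ}
    (hf : ∀ᶠ x in 𝓝 (ψ p₀), DifferentiableAt ℝ f x ∧ fderiv ℝ f x (X x) = c) :
    ∀ᶠ q in 𝓝 ((0 : ℝ), p₀), f (Φ q) = f (ψ q.2) + c * q.1 := by
  have hk' : (k : WithTop ℕ∞) ≠ 0 := by exact_mod_cast hk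
  have hconst := eventually_eq_of_hasDerivAt_zero (p₀ := p₀)
    (c := fun (_ : Unit) q => f (Φ q) - c * q.1) (by
      filter_upwards [h.contDiffAt, h.fderiv_time, h.tendsto.eventually hf] with q h1 h2 h3 _
      have hline : HasDerivAt (fun s : ℝ => q + s • ((1 : ℝ), (0 : P))) (1, 0) 0 := by
        simpa using ((hasDerivAt_id (0 : ℝ)).smul_const ((1 : ℝ), (0 : P))).const_add q
      have h4 : HasFDerivAt (fun q => f (Φ q) - c * q.1)
          ((fderiv ℝ f (Φ q)).comp (fderiv ℝ Φ q) - c • ContinuousLinearMap.fst ℝ ℝ P)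
          (q + (0 : ℝ) • ((1 : ℝ), (0 : P))) := by
        rw [zero_smul, add_zero]
        exact (h3.1.hasFDerivAt.comp q (h1.differentiableAt hk').hasFDerivAt).sub
          (hasFDerivAt_fst.const_smul c)
      have := h4.comp_hasDerivAt 0 hline
      simpa [h2, h3.2, Function.comp_def] using this)
  have hsnd : Tendsto (fun q : ℝ × P => q.2) (𝓝 (0, p₀)) (𝓝 p₀) := continuousAt_snd
  filter_upwards [hconst, hsnd.eventually h.initial] with q h1 h2
  have := h1 ()
  simp only [h2, mul_zero, sub_zero] at this
  linarith

end IsFlowout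

end Transport

/-! ### Local constructions with symplectic forms -/

section Local

variable {E V W : Type*} [NormedAddCommGroup E] [NormedSpace ℝ E]
  [NormedAddCommGroup V] [NormedSpace ℝ V] [NormedAddCommGroup W] [NormedSpace ℝ W]

/-- The inverse function theorem, with regularity on whole neighbourhoods. -/
theorem exists_local_diffeomorph [CompleteSpace E] {n : WithTop ℕ∞} (hn : n ≠ 0) {f : E → V}
    {a : E} (hf : ∀ᶠ x in 𝓝 a, ContDiffAt ℝ n f x) {f' : E ≃L[ℝ] V}
    (hf' : HasFDerivAt f (f' : E →L[ℝ] V) a) {p : E → Prop} (hp : ∀ᶠ x in 𝓝 a, p x) :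
    ∃ g : OpenPartialHomeomorph E V, (g : E → V) = f ∧ a ∈ g.source ∧
      (∀ x ∈ g.source, ContDiffAt ℝ n f x ∧ p x) ∧ ∀ y ∈ g.target, ContDiffAt ℝ n g.symm y := by
  have h1n : (1 : WithTop ℕ∞) ≤ n := by
    rcases eq_or_ne n 0 with h | h
    · exact absurd h hn
    · exact ENat.one_le_iff_ne_zero_withTop.2 h
  set g₀ := hf.self_of_nhds.toOpenPartialHomeomorph f hf' hn
  have hequiv : ∀ᶠ x in 𝓝 a, fderiv ℝ f x ∈ Set.range ((↑) : (E ≃L[ℝ] V) → _) := by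
    have hc : ContinuousAt (fderiv ℝ f) a :=
      (hf.self_of_nhds.fderiv_right (m := 0) (by simpa using h1n)).continuousAt
    refine hc.eventually ?_
    rw [hf'.fderiv]
    exact ContinuousLinearEquiv.nhds f'
  obtain ⟨s, hs, hso, has⟩ := eventually_nhds_iff.1 (hf.and (hequiv.and hp))
  refine ⟨g₀.restrOpen s hso, rfl,
    ⟨hf.self_of_nhds.mem_toOpenPartialHomeomorph_source hf' hn, has⟩,
    fun x hx => ⟨(hs x hx.2).1, (hs x hx.2).2.2⟩, fun y hy => ?_⟩
  have hx := (g₀.restrOpen s hso).map_target hy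
  obtain ⟨h1, ⟨e, he⟩, -⟩ := hs _ hx.2
  refine (g₀.restrOpen s hso).contDiffAt_symm (f₀' := e) hy ?_ h1
  rw [he]
  exact (h1.differentiableAt hn).hasFDerivAt

/-- Local coordinates in which a function becomes affine, and which preserve the linear forms
vanishing on a given transverse vector. -/
theorem exists_straightening [CompleteSpace V] {n : WithTop ℕ∞} (hn : n ≠ 0) {H : V → ℝ} {x₀ e : V}
    (hH : ∀ᶠ x in 𝓝 x₀, ContDiffAt ℝ n H x) (he : fderiv ℝ H x₀ e = 1) :
    ∃ τ : V → V, τ 0 = x₀ ∧ HasFDerivAt τ (ContinuousLinearMap.id ℝ V) 0 ∧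
      ∀ᶠ y in 𝓝 (0 : V), ContDiffAt ℝ n τ y ∧ H (τ y) = H x₀ + fderiv ℝ H x₀ y ∧
        ∀ G : V →L[ℝ] ℝ, G e = 0 → G (τ y) = G x₀ + G y := by
  set L := fderiv ℝ H x₀ with hL
  -- The nonlinear part of `H` is put in the direction `e`: since `L e = 1`, `L (χ x) = H x - H x₀`,
  -- and a form killing `e` does not see the correction. The required `τ` is the inverse of `χ`.
  set χ : V → V := fun x => (x - x₀) + (H x - H x₀ - L (x - x₀)) • e with hχ
  have hχ0 : χ x₀ = 0 := by simp [hχ]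
  have hsm : ∀ᶠ x in 𝓝 x₀, ContDiffAt ℝ n χ x := by
    filter_upwards [hH] with x hx
    have h1 : ContDiffAt ℝ n (fun x => x - x₀) x := contDiffAt_id.sub contDiffAt_const
    exact h1.add (((hx.sub contDiffAt_const).sub (L.contDiff.contDiffAt.comp x h1)).smul
      contDiffAt_const)
  have hd : HasFDerivAt χ ((ContinuousLinearEquiv.refl ℝ V : V ≃L[ℝ] V) : V →L[ℝ] V) x₀ := by
    have hid : HasFDerivAt (fun x : V => x - x₀) (ContinuousLinearMap.id ℝ V) x₀ :=
      (hasFDerivAt_id x₀).sub_const x₀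
    have hLd : HasFDerivAt (fun x : V => L (x - x₀)) L x₀ := by
      exact L.hasFDerivAt.comp x₀ hid
    have h := hid.add ((((hH.self_of_nhds.differentiableAt hn).hasFDerivAt.sub_const
      (H x₀)).sub hLd).smul_const e)
    refine HasFDerivAt.congr_fderiv (f := χ) h ?_
    ext v
    simp [hL]
  obtain ⟨g, hg, hx₀, -, hsymm⟩ := exists_local_diffeomorph hn hsm hd (p := fun _ => True) (by simp)
  have h0 : (0 : V) ∈ g.target := by
    have := g.map_source hx₀
    rwa [hg, hχ0] at this
  have hτ0 : g.symm 0 = x₀ := by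
    have := g.left_inv hx₀
    rwa [hg, hχ0] at this
  refine ⟨g.symm, hτ0, ?_, ?_⟩
  · have := g.hasFDerivAt_symm (f' := ContinuousLinearEquiv.refl ℝ V) h0 (by rw [hτ0, hg]; exact hd)
    exact this
  · filter_upwards [g.open_target.mem_nhds h0] with y hy
    have hy' : χ (g.symm y) = y := by
      have := g.right_inv hy
      rwa [hg] at this
    refine ⟨hsymm y hy, ?_, fun G hG => ?_⟩
    · have := congrArg L hy'
      simp only [hχ, map_add, map_smul, he, smul_eq_mul, mul_one] at this
      linarith
    · have := congrArg G hy'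
      simp only [hχ, map_add, map_smul, hG, smul_eq_mul, mul_zero, add_zero, map_sub] at this
      linarith

/-- A 1-form is locally the contraction of a given symplectic form with a vector field. -/
theorem IsSymplecticNear.exists_dual_field [FiniteDimensional ℝ V] {k : ℕ∞}
    {B : V → V →L[ℝ] V →L[ℝ] ℝ} {x₀ : V} (hB : IsSymplecticNear k B x₀) {α : V → V →L[ℝ] ℝ}
    (hα : ∀ᶠ x in 𝓝 x₀, ContDiffAt ℝ k α x) :
    ∃ X : V → V, ∀ᶠ x in 𝓝 x₀, ContDiffAt ℝ k X x ∧ B x (X x) = α x := by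
  have : CompleteSpace V := FiniteDimensional.complete ℝ V
  have hinj : Function.Injective (B x₀) := by
    rw [injective_iff_map_eq_zero]
    exact fun u hu => hB.nondegenerate u fun v => by rw [hu]; rfl
  have hdim : Module.finrank ℝ V = Module.finrank ℝ (V →L[ℝ] ℝ) := by
    rw [← (LinearMap.toContinuousLinearMap (𝕜 := ℝ) (E := V) (F' := ℝ)).finrank_eq]
    exact (Subspace.dual_finrank_eq (K := ℝ) (V := V)).symm
  let e : V ≃L[ℝ] (V →L[ℝ] ℝ) :=
    (LinearEquiv.ofInjectiveOfFinrankEq (B x₀ : V →ₗ[ℝ] V →L[ℝ] ℝ) hinj hdim).toContinuousLinearEquiv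
  have he : (e : V →L[ℝ] V →L[ℝ] ℝ) = B x₀ := by ext; rfl
  have hequiv : ∀ᶠ x in 𝓝 x₀, B x ∈ Set.range ((↑) : (V ≃L[ℝ] (V →L[ℝ] ℝ)) → _) := by
    refine hB.contDiffAt.self_of_nhds.continuousAt.eventually ?_
    rw [← he]
    exact ContinuousLinearEquiv.nhds e
  refine ⟨fun x => (B x).inverse (α x), ?_⟩
  filter_upwards [hequiv, hB.contDiffAt, hα] with x ⟨e', he'⟩ h2 h3
  refine ⟨?_, ?_⟩
  · have hinv : ContDiffAt ℝ k (ContinuousLinearMap.inverse (R := ℝ) (M := V) (M₂ := V →L[ℝ] ℝ))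
        (B x) := by
      rw [← he']
      exact contDiffAt_map_inverse e'
    exact (hinv.comp x h2).clm_apply h3
  · rw [← he', ContinuousLinearMap.inverse_equiv]
    exact e'.apply_symm_apply _

/-- The pull-back of a field of bilinear forms. -/
def pullbackBilin (B : V → V →L[ℝ] V →L[ℝ] ℝ) (σ : W → V) (z : W) : W →L[ℝ] W →L[ℝ] ℝ :=
  (B (σ z)).bilinearComp (fderiv ℝ σ z) (fderiv ℝ σ z)

@[simp]
theorem pullbackBilin_apply (B : V → V →L[ℝ] V →L[ℝ] ℝ) (σ : W → V) (z u v : W) :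
    pullbackBilin B σ z u v = B (σ z) (fderiv ℝ σ z u) (fderiv ℝ σ z v) := rfl

/-- The coefficients involve `fderiv ℝ σ`, hence the extra derivative on `σ`. This is what forces
the level set to be parametrized in class `C^(k+1)`. -/
theorem contDiffAt_pullbackBilin {n : WithTop ℕ∞} {B : V → V →L[ℝ] V →L[ℝ] ℝ} {σ : W → V} {z : W}
    (hB : ContDiffAt ℝ n B (σ z)) (hσ : ContDiffAt ℝ (n + 1) σ z) :
    ContDiffAt ℝ n (pullbackBilin B σ) z := by
  have hd : ContDiffAt ℝ n (fderiv ℝ σ) z := hσ.fderiv_right le_rfl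
  have h1 : ContDiffAt ℝ n (fun z => (B (σ z)).comp (fderiv ℝ σ z)) z :=
    (hB.comp z (hσ.of_le le_self_add)).clm_comp hd
  have h2 : ContDiffAt ℝ n
      (fun z => (ContinuousLinearMap.compL ℝ W V ℝ).flip (fderiv ℝ σ z)) z :=
    contDiffAt_const.clm_apply hd
  exact h2.clm_comp h1

theorem fderiv_clm_apply_apply {B : W → V →L[ℝ] V →L[ℝ] ℝ} {f g : W → V} {z : W}
    (hB : DifferentiableAt ℝ B z) (hf : DifferentiableAt ℝ f z) (hg : DifferentiableAt ℝ g z)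
    (w : W) :
    fderiv ℝ (fun z => B z (f z) (g z)) z w =
      fderiv ℝ B z w (f z) (g z) + B z (fderiv ℝ f z w) (g z) + B z (f z) (fderiv ℝ g z w) := by
  rw [((hB.hasFDerivAt.clm_apply hf.hasFDerivAt).clm_apply hg.hasFDerivAt).fderiv]
  simp
  ring

/-- In the cyclic sum the terms with second derivatives of `σ` cancel in pairs, by symmetry of the
second derivative and antisymmetry of `B`. -/
theorem isClosedAt_pullbackBilin {B : V → V →L[ℝ] V →L[ℝ] ℝ} {σ : W → V} {z : W}
    (halt : ∀ x u, B x u u = 0) (hB : ContDiffAt ℝ 1 B (σ z)) (hσ : ContDiffAt ℝ 2 σ z)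
    (hcl : IsClosedAt B (σ z)) : IsClosedAt (pullbackBilin B σ) z := by
  have hσ1 : DifferentiableAt ℝ σ z := hσ.differentiableAt two_ne_zero
  have hd : DifferentiableAt ℝ (fderiv ℝ σ) z :=
    (hσ.fderiv_right (m := 1) (by norm_num)).differentiableAt one_ne_zero
  have hBd : DifferentiableAt ℝ B (σ z) := hB.differentiableAt one_ne_zero
  have hP : DifferentiableAt ℝ (pullbackBilin B σ) z :=
    (contDiffAt_pullbackBilin (n := 1) hB (hσ.of_le (by norm_num))).differentiableAt one_ne_zero
  have hsymm : ∀ u v, fderiv ℝ (fderiv ℝ σ) z u v = fderiv ℝ (fderiv ℝ σ) z v u := fun u v =>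
    (hσ.isSymmSndFDerivAt (by simp)) u v
  have hdu : ∀ u w : W, fderiv ℝ (fun z => fderiv ℝ σ z u) z w = fderiv ℝ (fderiv ℝ σ) z w u := by
    intro u w
    rw [(hd.hasFDerivAt.clm_apply (hasFDerivAt_const u z)).fderiv]
    simp
  have key : ∀ w u v : W, fderiv ℝ (pullbackBilin B σ) z w u v =
      fderiv ℝ B (σ z) (fderiv ℝ σ z w) (fderiv ℝ σ z u) (fderiv ℝ σ z v) +
      B (σ z) (fderiv ℝ (fderiv ℝ σ) z w u) (fderiv ℝ σ z v) +
      B (σ z) (fderiv ℝ σ z u) (fderiv ℝ (fderiv ℝ σ) z w v) := by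
    intro w u v
    have h1 : fderiv ℝ (pullbackBilin B σ) z w u v =
        fderiv ℝ (fun z => pullbackBilin B σ z u v) z w := by
      rw [fderiv_clm_apply_apply hP (differentiableAt_const u) (differentiableAt_const v)]
      simp
    have h2 : fderiv ℝ (fun z => B (σ z)) z = (fderiv ℝ B (σ z)).comp (fderiv ℝ σ z) :=
      fderiv_comp (F := V) (G := V →L[ℝ] V →L[ℝ] ℝ) z hBd hσ1
    rw [h1]
    simp only [pullbackBilin_apply]
    have h3 : DifferentiableAt ℝ (fun z => B (σ z)) z :=
      DifferentiableAt.comp (F := V) (G := V →L[ℝ] V →L[ℝ] ℝ) z hBd hσ1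
    rw [fderiv_clm_apply_apply h3 (hd.clm_apply (differentiableAt_const u))
      (hd.clm_apply (differentiableAt_const v)), hdu, hdu]
    simp only [h2]
    rfl
  intro u v w
  rw [key, key, key]
  have h := hcl (fderiv ℝ σ z u) (fderiv ℝ σ z v) (fderiv ℝ σ z w)
  have a1 := antisymm_of_alternating (halt (σ z)) (fderiv ℝ σ z v) (fderiv ℝ (fderiv ℝ σ) z u w)
  have a2 := antisymm_of_alternating (halt (σ z)) (fderiv ℝ σ z w) (fderiv ℝ (fderiv ℝ σ) z v u)
  have a3 := antisymm_of_alternating (halt (σ z)) (fderiv ℝ σ z u) (fderiv ℝ (fderiv ℝ σ) z w v)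
  rw [hsymm u w] at a1 ⊢
  rw [hsymm v u] at a2 ⊢
  rw [hsymm w v] at a3 ⊢
  linarith

/-- The orthogonal of a hyperbolic pair for an alternating bilinear form. -/
def hyperbolicOrthogonal (b : V →L[ℝ] V →L[ℝ] ℝ) (X e : V) : Submodule ℝ V :=
  LinearMap.ker ((b X : V →ₗ[ℝ] ℝ).prod (b e : V →ₗ[ℝ] ℝ))

theorem mem_hyperbolicOrthogonal {b : V →L[ℝ] V →L[ℝ] ℝ} {X e v : V} :
    v ∈ hyperbolicOrthogonal b X e ↔ b X v = 0 ∧ b e v = 0 := by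
  simp [hyperbolicOrthogonal]

theorem finrank_hyperbolicOrthogonal [FiniteDimensional ℝ V] {b : V →L[ℝ] V →L[ℝ] ℝ} {X e : V}
    (hb : ∀ u, b u u = 0) (he : b X e = 1) :
    Module.finrank ℝ (hyperbolicOrthogonal b X e) + 2 = Module.finrank ℝ V := by
  have hsurj : Function.Surjective ((b X : V →ₗ[ℝ] ℝ).prod (b e : V →ₗ[ℝ] ℝ)) := by
    rintro ⟨s, t⟩
    refine ⟨s • e - t • X, ?_⟩
    have := antisymm_of_alternating hb e X
    simp [hb, he, this]
  have h := ((b X : V →ₗ[ℝ] ℝ).prod (b e : V →ₗ[ℝ] ℝ)).finrank_range_add_finrank_ker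
  rw [LinearMap.range_eq_top.2 hsurj, finrank_top] at h
  simp only [Module.finrank_prod, Module.finrank_self] at h
  rw [hyperbolicOrthogonal]
  omega

/-- Every `v` differs from its projection `v - b X v • e + b e v • X` to the orthogonal by a
combination of `X` and `e`, on which `b u` vanishes. -/
theorem nondegenerate_hyperbolicOrthogonal {b : V →L[ℝ] V →L[ℝ] ℝ} {X e : V}
    (hb : ∀ u, b u u = 0) (he : b X e = 1) (hnd : ∀ u, (∀ v, b u v = 0) → u = 0) {u : V}
    (hu : u ∈ hyperbolicOrthogonal b X e) (h : ∀ v ∈ hyperbolicOrthogonal b X e, b u v = 0) :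
    u = 0 := by
  refine hnd u fun v => ?_
  obtain ⟨h1, h2⟩ := mem_hyperbolicOrthogonal.1 hu
  have hmem : v - b X v • e + b e v • X ∈ hyperbolicOrthogonal b X e := by
    have := antisymm_of_alternating hb e X
    rw [mem_hyperbolicOrthogonal]
    simp [hb, he, this]
  have := h _ hmem
  have h3 := antisymm_of_alternating hb u X
  have h4 := antisymm_of_alternating hb u e
  simpa [h3, h4, h1, h2] using this

end Local

/-! ### The flowbox theorem in a vector space -/

section Coordinates

/-- The index in `Fin (2 * (d + 1))` corresponding to an index in `Fin (2 * d)`, when the first pair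
of conjugate indices is skipped. -/
def shiftIdx {d : ℕ} (j : Fin (2 * d)) : Fin (2 * (d + 1)) :=
  if (j : ℕ) < d then ⟨j + 1, by omega⟩ else ⟨j + 2, by omega⟩

theorem shiftIdx_lowIdx {d : ℕ} (i : Fin d) : shiftIdx (lowIdx i) = lowIdx i.succ := by
  ext
  simp [shiftIdx, lowIdx]

theorem shiftIdx_highIdx {d : ℕ} (i : Fin d) : shiftIdx (highIdx i) = highIdx i.succ := by
  ext
  simp [shiftIdx, highIdx]
  omega

/-- The coordinates of `ℝ^{2(d+1)}` without the first pair of conjugate coordinates. -/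
def dropPair (d : ℕ) :
    EuclideanSpace ℝ (Fin (2 * (d + 1))) →L[ℝ] EuclideanSpace ℝ (Fin (2 * d)) :=
  LinearMap.toContinuousLinearMap
    { toFun := fun y => WithLp.toLp 2 fun j => y (shiftIdx j)
      map_add' := fun _ _ => rfl
      map_smul' := fun _ _ => rfl }

@[simp]
theorem dropPair_apply {d : ℕ} (y : EuclideanSpace ℝ (Fin (2 * (d + 1)))) (j : Fin (2 * d)) :
    dropPair d y j = y (shiftIdx j) := rfl

/-- The splitting `y ↦ (y_1, (y_{d+1}, other coordinates))`. -/
def splitPair (d : ℕ) :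
    EuclideanSpace ℝ (Fin (2 * (d + 1))) →L[ℝ] ℝ × (ℝ × EuclideanSpace ℝ (Fin (2 * d))) :=
  (EuclideanSpace.proj (lowIdx 0)).prod ((EuclideanSpace.proj (highIdx 0)).prod (dropPair d))

@[simp]
theorem splitPair_apply {d : ℕ} (y : EuclideanSpace ℝ (Fin (2 * (d + 1)))) :
    splitPair d y = (y (lowIdx 0), (y (highIdx 0), dropPair d y)) := rfl

theorem splitPair_partialOne (d : ℕ) : splitPair d (partialOne (d + 1)) = (1, 0) := by
  have h : ∀ j : Fin (2 * (d + 1)), j ≠ lowIdx 0 → partialOne (d + 1) j = 0 := fun j hj => by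
    simp [partialOne, hj]
  rw [splitPair_apply]
  refine Prod.ext (by simp [partialOne]) (Prod.ext ?_ ?_)
  · exact h (highIdx 0) (by simp [lowIdx, highIdx, Fin.ext_iff])
  · ext j
    refine h _ ?_
    simp only [shiftIdx, lowIdx, ne_eq, Fin.ext_iff]
    split_ifs <;> simp

theorem canonicalForm_apply {d : ℕ} (w w' : EuclideanSpace ℝ (Fin (2 * d))) :
    canonicalForm d ![w, w'] =
      ∑ i : Fin d, (w (lowIdx i) * w' (highIdx i) - w' (lowIdx i) * w (highIdx i)) := rfl

theorem canonicalForm_succ {d : ℕ} (w w' : EuclideanSpace ℝ (Fin (2 * (d + 1)))) :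
    canonicalForm (d + 1) ![w, w'] =
      w (lowIdx 0) * w' (highIdx 0) - w' (lowIdx 0) * w (highIdx 0) +
        canonicalForm d ![dropPair d w, dropPair d w'] := by
  simp only [canonicalForm_apply, Fin.sum_univ_succ, dropPair_apply, shiftIdx_lowIdx,
    shiftIdx_highIdx]

end Coordinates

/-! ### Darboux's theorem and the flowbox parametrization, by induction on `d` -/

section Induction

variable {V : Type} [NormedAddCommGroup V] [NormedSpace ℝ V]

/-- `Ψ` is a `C^k` symplectic parametrization, near `0`, of a neighbourhood of `x₀`. -/
structure IsDarbouxParametrization {d : ℕ} (k : ℕ∞) (B : V → V →L[ℝ] V →L[ℝ] ℝ) (x₀ : V)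
    (Ψ : EuclideanSpace ℝ (Fin (2 * d)) → V) : Prop where
  map_zero : Ψ 0 = x₀
  contDiffAt : ∀ᶠ y in 𝓝 0, ContDiffAt ℝ k Ψ y
  pullback_eq : ∀ᶠ y in 𝓝 0, ∀ w w',
    B (Ψ y) (fderiv ℝ Ψ y w) (fderiv ℝ Ψ y w') = canonicalForm d ![w, w']

/-- **Darboux's theorem** in dimension `2 * d` and regularity `C^k`. -/
def DarbouxStatement (k : ℕ∞) (d : ℕ) : Prop :=
  ∀ (V : Type) [NormedAddCommGroup V] [NormedSpace ℝ V] [FiniteDimensional ℝ V]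
    (B : V → V →L[ℝ] V →L[ℝ] ℝ) (x₀ : V), Module.finrank ℝ V = 2 * d → IsSymplecticNear k B x₀ →
    ∃ Ψ : EuclideanSpace ℝ (Fin (2 * d)) → V, IsDarbouxParametrization k B x₀ Ψ

/-- Since `τ` has derivative the identity at `0`, the pull-back there is the restriction of `B x₀`
to `W`, and nondegeneracy is linear algebra. -/
theorem isSymplecticNear_pullbackBilin {k : ℕ∞} (hk : k ≠ 0) {B : V → V →L[ℝ] V →L[ℝ] ℝ} {x₀ : V}
    (hB : IsSymplecticNear k B x₀) {W : Submodule ℝ V} {τ : V → V} (hτ0 : τ 0 = x₀)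
    (hτd : HasFDerivAt τ (ContinuousLinearMap.id ℝ V) 0)
    (hτ : ∀ᶠ y in 𝓝 (0 : V), ContDiffAt ℝ (k + 1 : ℕ∞) τ y)
    (hW : ∀ u ∈ W, (∀ v ∈ W, B x₀ u v = 0) → u = 0) :
    IsSymplecticNear k (pullbackBilin B fun z : W => τ z) 0 := by
  have hW0 : Tendsto (fun z : W => (z : V)) (𝓝 0) (𝓝 0) :=
    continuous_subtype_val.tendsto (0 : W)
  have hτc : Tendsto (fun z : W => τ z) (𝓝 0) (𝓝 x₀) := by
    have := (hτd.continuousAt.tendsto).comp hW0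
    rwa [hτ0] at this
  have hσ : ∀ᶠ z : W in 𝓝 0, ContDiffAt ℝ (k + 1 : ℕ∞) (fun z : W => τ z) z := by
    filter_upwards [hW0.eventually hτ] with z hz
    exact hz.comp z W.subtypeL.contDiff.contDiffAt
  have h1k : (1 : ℕ∞) ≤ k := Order.one_le_iff_ne_zero.2 hk
  have h2k : (2 : WithTop ℕ∞) ≤ (k + 1 : ℕ∞) := by
    push_cast
    rw [← one_add_one_eq_two]
    gcongr
    exact_mod_cast h1k
  refine ⟨fun z u => hB.alternating _ _, ?_, ?_, ?_⟩
  · filter_upwards [hτc.eventually hB.contDiffAt, hσ] with z h1 h2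
    exact contDiffAt_pullbackBilin h1 (by exact_mod_cast h2)
  · filter_upwards [hτc.eventually hB.contDiffAt, hτc.eventually hB.closed, hσ] with z h1 h2 h3
    exact isClosedAt_pullbackBilin hB.alternating (h1.of_le (by exact_mod_cast h1k))
      (h3.of_le h2k) h2
  · intro u hu
    have hd : HasFDerivAt (fun z : W => τ z)
        ((ContinuousLinearMap.id ℝ V).comp W.subtypeL) 0 :=
      HasFDerivAt.comp (g := τ) (0 : W) (by simpa using hτd) W.subtypeL.hasFDerivAt
    refine Subtype.ext (hW u u.2 fun v hv => ?_)
    have := hu ⟨v, hv⟩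
    rw [pullbackBilin_apply, hd.fderiv] at this
    simpa [hτ0] using this

/-- Flowing out a Darboux parametrization of the codimension-two submanifold `G = H = const`
along the normalized Hamiltonian field of `G` and then along that of `H`. -/
theorem exists_flowbox_of_darboux [FiniteDimensional ℝ V] {k : ℕ∞} (hk : k ≠ 0) {d : ℕ}
    (hd : DarbouxStatement k d) {B : V → V →L[ℝ] V →L[ℝ] ℝ} {x₀ : V}
    (hV : Module.finrank ℝ V = 2 * (d + 1)) (hB : IsSymplecticNear k B x₀) {H : V → ℝ}
    (hH : ∀ᶠ x in 𝓝 x₀, ContDiffAt ℝ (k + 1 : ℕ∞) H x) (hdH : fderiv ℝ H x₀ ≠ 0) :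
    ∃ Ψ : EuclideanSpace ℝ (Fin (2 * (d + 1))) → V, IsDarbouxParametrization k B x₀ Ψ ∧
      (∀ᶠ y in 𝓝 0, H (Ψ y) = H x₀ + y (highIdx 0)) ∧
      ∀ᶠ y in 𝓝 0, B (Ψ y) (fderiv ℝ Ψ y (partialOne (d + 1))) = fderiv ℝ H (Ψ y) := by
  have : CompleteSpace V := FiniteDimensional.complete ℝ V
  have hk' : (k : WithTop ℕ∞) ≠ 0 := by exact_mod_cast hk
  have hk1 : ((k + 1 : ℕ∞) : WithTop ℕ∞) ≠ 0 := by
    exact_mod_cast (by simp : (k + 1 : ℕ∞) ≠ 0)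
  have h1k : (1 : ℕ∞) ≤ k := Order.one_le_iff_ne_zero.2 hk
  have h2k : (2 : WithTop ℕ∞) ≤ (k + 1 : ℕ∞) := by
    push_cast
    rw [← one_add_one_eq_two]
    gcongr
    exact_mod_cast h1k
  have hdHsm : ∀ᶠ x in 𝓝 x₀, ContDiffAt ℝ k (fderiv ℝ H) x := by
    filter_upwards [hH] with x hx
    exact hx.fderiv_right (by push_cast; exact le_rfl)
  -- the Hamiltonian field of `H`, a transverse vector `e`, and the second function `G`
  obtain ⟨X, hX⟩ := hB.exists_dual_field hdHsm
  have hX₀ := hX.self_of_nhds.2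
  obtain ⟨e, he⟩ : ∃ e, fderiv ℝ H x₀ e = 1 := by
    obtain ⟨v, hv⟩ := ContinuousLinearMap.exists_ne_zero hdH
    exact ⟨(fderiv ℝ H x₀ v)⁻¹ • v, by simp [hv]⟩
  have hXe : B x₀ (X x₀) e = 1 := by rw [hX₀, he]
  -- A linear `G` has constant differential, so its Hamiltonian field is as smooth as `B`; moreover
  -- `G e = 0`, so the straightening of `H` preserves it. The field `Y` takes the value `e` at `x₀`.
  set G : V →L[ℝ] ℝ := B x₀ e with hG
  obtain ⟨Y, hY⟩ := hB.exists_dual_field (α := fun _ => G)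
    (Eventually.of_forall fun _ => contDiffAt_const)
  set f : V → ℝ := fun x => fderiv ℝ H x (Y x) with hf
  have hfsm : ∀ᶠ x in 𝓝 x₀, ContDiffAt ℝ k f x := by
    filter_upwards [hdHsm, hY] with x h1 h2
    exact h1.clm_apply h2.1
  have hf₀ : f x₀ = 1 := by
    have h1 := antisymm_of_alternating (hB.alternating x₀) (X x₀) (Y x₀)
    have h2 := antisymm_of_alternating (hB.alternating x₀) (X x₀) e
    rw [hY.self_of_nhds.2, hX₀] at h1
    rw [hX₀, he] at h2
    rw [hf]
    simp only
    rw [h1, h2]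
  have hfne : ∀ᶠ x in 𝓝 x₀, f x ≠ 0 :=
    hfsm.self_of_nhds.continuousAt.eventually_ne (by rw [hf₀]; exact one_ne_zero)
  -- Dividing by `f` makes `H` grow at unit speed, at the price that `K` need not be Hamiltonian.
  set K : V → V := fun x => (f x)⁻¹ • Y x with hK
  have hfinv : ∀ᶠ x in 𝓝 x₀, ContDiffAt ℝ k (fun x => (f x)⁻¹) x := by
    filter_upwards [hfsm, hfne] with x h1 h2
    exact h1.inv h2
  have hKsm : ∀ᶠ x in 𝓝 x₀, ContDiffAt ℝ k K x := by
    filter_upwards [hfinv, hY] with x h1 h2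
    exact h1.smul h2.1
  have hKB : ∀ᶠ x in 𝓝 x₀, B x (K x) = (f x)⁻¹ • G := by
    filter_upwards [hY] with x h1
    rw [hK]
    simp only
    rw [map_smul, h1.2]
  have hKH : ∀ᶠ x in 𝓝 x₀, DifferentiableAt ℝ H x ∧ fderiv ℝ H x (K x) = 1 := by
    filter_upwards [hH, hfne] with x h1 h2
    refine ⟨h1.differentiableAt hk1, ?_⟩
    rw [hK]
    simp only
    rw [map_smul, smul_eq_mul]
    exact inv_mul_cancel₀ h2
  have hKG : ∀ᶠ x in 𝓝 x₀, DifferentiableAt ℝ G x ∧ fderiv ℝ G x (K x) = 0 := by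
    filter_upwards [hY] with x h1
    refine ⟨G.differentiableAt, ?_⟩
    have h2 : G (Y x) = 0 := by rw [← h1.2]; exact hB.alternating x _
    rw [G.fderiv, hK]
    simp only
    rw [map_smul, h2, smul_zero]
  -- a parametrization of the submanifold `H = H x₀`, `G = G x₀`
  obtain ⟨τ, hτ0, hτd, hτ⟩ := exists_straightening hk1 hH he
  -- This is the common kernel of `dH` and `G` at `x₀`; `τ` carries it, near `0`, into the level set
  -- of `H` and `G`.
  set W := hyperbolicOrthogonal (B x₀) (X x₀) e with hW
  have hfin : Module.finrank ℝ W = 2 * d := by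
    have h : Module.finrank ℝ W + 2 = Module.finrank ℝ V :=
      finrank_hyperbolicOrthogonal (hB.alternating x₀) hXe
    rw [hV] at h
    omega
  obtain ⟨ψ, hψ⟩ := hd W (pullbackBilin B fun z : W => τ z) 0 hfin
    (isSymplecticNear_pullbackBilin hk hB hτ0 hτd (hτ.mono fun _ h => h.1) fun u hu h =>
      nondegenerate_hyperbolicOrthogonal (hB.alternating x₀) hXe hB.nondegenerate hu h)
  have hψ0 : Tendsto ψ (𝓝 0) (𝓝 0) := by
    have := hψ.contDiffAt.self_of_nhds.continuousAt.tendsto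
    rwa [hψ.map_zero] at this
  have hψV : Tendsto (fun y => (ψ y : V)) (𝓝 0) (𝓝 0) :=
    (continuous_subtype_val.tendsto (0 : W)).comp hψ0
  set θ : EuclideanSpace ℝ (Fin (2 * d)) → V := fun y => τ (ψ y) with hθ
  have hθ0 : θ 0 = x₀ := by rw [hθ]; simp only [hψ.map_zero]; exact hτ0
  have hτW : ∀ᶠ y in 𝓝 (0 : EuclideanSpace ℝ (Fin (2 * d))),
      ContDiffAt ℝ (k + 1 : ℕ∞) (fun z : W => τ z) (ψ y) := by
    filter_upwards [hψV.eventually hτ] with y hy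
    exact hy.1.comp (ψ y) W.subtypeL.contDiff.contDiffAt
  have hθsm : ∀ᶠ y in 𝓝 0, ContDiffAt ℝ k θ y := by
    filter_upwards [hτW, hψ.contDiffAt] with y h1 h2
    exact (h1.of_le (by push_cast; exact le_self_add)).comp y h2
  have hθB : ∀ᶠ y in 𝓝 0, ∀ w w',
      B (θ y) (fderiv ℝ θ y w) (fderiv ℝ θ y w') = canonicalForm d ![w, w'] := by
    filter_upwards [hτW, hψ.contDiffAt, hψ.pullback_eq] with y h1 h2 h3 w w'
    have h4 : fderiv ℝ θ y = (fderiv ℝ (fun z : W => τ z) (ψ y)).comp (fderiv ℝ ψ y) :=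
      fderiv_comp (g := fun z : W => τ z) y (h1.differentiableAt hk1) (h2.differentiableAt hk')
    rw [h4, ← h3]
    rfl
  have hθH : ∀ᶠ y in 𝓝 0, H (θ y) = H x₀ := by
    filter_upwards [hψV.eventually hτ] with y hy
    have h1 : fderiv ℝ H x₀ (ψ y) = 0 := by
      rw [← hX₀]
      exact (mem_hyperbolicOrthogonal.1 (ψ y).2).1
    rw [hθ]
    simp only
    rw [hy.2.1, h1, add_zero]
  have hθG : ∀ᶠ y in 𝓝 0, G (θ y) = G x₀ := by
    filter_upwards [hψV.eventually hτ] with y hy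
    rw [hθ]
    simp only
    rw [hy.2.2 G (hB.alternating x₀ e), (mem_hyperbolicOrthogonal.1 (ψ y).2).2, add_zero]
  -- first flow-out
  rw [← hθ0] at hX hB hH hKsm hKB hKH hKG hfinv hdHsm
  obtain ⟨Φ, hΦ⟩ := exists_isFlowout hk hKsm hθsm
  have hsnd : Tendsto (fun q : ℝ × EuclideanSpace ℝ (Fin (2 * d)) => q.2) (𝓝 (0, 0)) (𝓝 0) :=
    continuousAt_snd
  have hΦG : ∀ᶠ q in 𝓝 (0, 0), G (Φ q) = G x₀ := by
    filter_upwards [hΦ.eventually_apply_eq hk hKG, hsnd.eventually hθG] with q h1 h2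
    rw [h1, h2, zero_mul, add_zero]
  have hΦGd : ∀ᶠ q in 𝓝 (0, 0), ∀ w, G (fderiv ℝ Φ q w) = 0 := by
    filter_upwards [hΦG.eventually_nhds, hΦ.contDiffAt] with q h1 h2 w
    have h3 : HasFDerivAt (fun q => G (Φ q)) (G.comp (fderiv ℝ Φ q)) q :=
      G.hasFDerivAt.comp q (h2.differentiableAt hk').hasFDerivAt
    have h4 : HasFDerivAt (fun q => G (Φ q))
        (0 : ℝ × EuclideanSpace ℝ (Fin (2 * d)) →L[ℝ] ℝ) q :=
      (hasFDerivAt_const (G x₀) q).congr_of_eventuallyEq h1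
    exact congrArg (fun l => l w) (h3.unique h4)
  have hΦH : ∀ᶠ q in 𝓝 (0, 0), H (Φ q) = H x₀ + q.1 := by
    filter_upwards [hΦ.eventually_apply_eq hk hKH, hsnd.eventually hθH] with q h1 h2
    rw [h1, h2, one_mul]
  have hΦB : ∀ᶠ q in 𝓝 (0, 0), ∀ w w',
      B (Φ q) (fderiv ℝ Φ q w) (fderiv ℝ Φ q w') = canonicalForm d ![w.2, w'.2] := by
    -- The contraction is `f⁻¹ • G`, with `G` constant, so its derivative is a multiple of `G`,
    -- which vanishes on vectors tangent to the flow-out.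
    have hα : ∀ᶠ q in 𝓝 ((0 : ℝ), (0 : EuclideanSpace ℝ (Fin (2 * d)))),
        ∀ w w' : ℝ × EuclideanSpace ℝ (Fin (2 * d)),
        fderiv ℝ (fun x => B x (K x)) (Φ q) (fderiv ℝ Φ q w) (fderiv ℝ Φ q w') = 0 := by
      filter_upwards [hΦ.tendsto.eventually hKB.eventually_nhds, hΦ.tendsto.eventually hfinv,
        hΦGd] with q h1 h2 h3 w w'
      have h4 : fderiv ℝ (fun x => B x (K x)) (Φ q) =
          (fderiv ℝ (fun x => (f x)⁻¹) (Φ q)).smulRight G := by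
        rw [Filter.EventuallyEq.fderiv_eq h1]
        exact ((h2.differentiableAt hk').hasFDerivAt.smul_const G).fderiv
      rw [h4]
      simp [h3]
    have hθGd : ∀ᶠ y in 𝓝 (0 : EuclideanSpace ℝ (Fin (2 * d))),
        ∀ w, G (fderiv ℝ θ y w) = 0 := by
      have hin : Tendsto (fun y : EuclideanSpace ℝ (Fin (2 * d)) => ((0 : ℝ), y)) (𝓝 0)
          (𝓝 (0, 0)) :=
        (by fun_prop : Continuous fun y : EuclideanSpace ℝ (Fin (2 * d)) => ((0 : ℝ), y)).tendsto 0
      filter_upwards [hin.eventually hΦGd, hΦ.eventually_fderiv_initial hk] with y h1 h2 w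
      have := h1 (0, w)
      rwa [h2, zero_smul, zero_add] at this
    have hθKB : ∀ᶠ y in 𝓝 (0 : EuclideanSpace ℝ (Fin (2 * d))),
        B (θ y) (K (θ y)) = (f (θ y))⁻¹ • G :=
      (hθsm.self_of_nhds.continuousAt).eventually hKB
    filter_upwards [hΦ.eventually_pullback_eq hk hKsm hB (hα.mono fun q h w w' => by
      rw [h, h]), hsnd.eventually hθB, hsnd.eventually hθGd, hsnd.eventually hθKB]
      with q h1 h2 h3 h4 w w'
    rw [h1, h2, h4]
    simp [h3]
  -- second flow-out
  have hΦ₀ : Φ (0, 0) = θ 0 := hΦ.initial.self_of_nhds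
  rw [← hΦ₀] at hX hB hH hdHsm
  obtain ⟨Ξ, hΞ⟩ := exists_isFlowout hk (hX.mono fun _ h => h.1) hΦ.contDiffAt
  have hsnd' : Tendsto (fun q : ℝ × (ℝ × EuclideanSpace ℝ (Fin (2 * d))) => q.2) (𝓝 (0, (0, 0)))
    (𝓝 (0, 0)) := continuousAt_snd
  have hΞH : ∀ᶠ q in 𝓝 (0, (0, 0)), H (Ξ q) = H x₀ + q.2.1 := by
    have hXH : ∀ᶠ x in 𝓝 (Φ (0, 0)), DifferentiableAt ℝ H x ∧ fderiv ℝ H x (X x) = 0 := by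
      filter_upwards [hH, hX] with x h1 h2
      refine ⟨h1.differentiableAt hk1, ?_⟩
      rw [← h2.2]
      exact hB.alternating x _
    filter_upwards [hΞ.eventually_apply_eq hk hXH, hsnd'.eventually hΦH] with q h1 h2
    rw [h1, h2, zero_mul, add_zero]
  have hΞB : ∀ᶠ q in 𝓝 (0, (0, 0)), ∀ w w', B (Ξ q) (fderiv ℝ Ξ q w) (fderiv ℝ Ξ q w') =
      w.1 * w'.2.1 - w'.1 * w.2.1 + canonicalForm d ![w.2.2, w'.2.2] := by
    have hα : ∀ᶠ q in 𝓝 ((0 : ℝ), ((0 : ℝ), (0 : EuclideanSpace ℝ (Fin (2 * d))))),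
        ∀ w w' : ℝ × (ℝ × EuclideanSpace ℝ (Fin (2 * d))),
        fderiv ℝ (fun x => B x (X x)) (Ξ q) (fderiv ℝ Ξ q w) (fderiv ℝ Ξ q w') =
        fderiv ℝ (fun x => B x (X x)) (Ξ q) (fderiv ℝ Ξ q w') (fderiv ℝ Ξ q w) := by
      filter_upwards [hΞ.tendsto.eventually hX.eventually_nhds, hΞ.tendsto.eventually hH]
        with q h1 h2 w w'
      -- Here the contraction is `dH`, whose closedness is the symmetry of the second derivative of
      -- `H`.
      have h3 : (fun x => B x (X x)) =ᶠ[𝓝 (Ξ q)] fderiv ℝ H := h1.mono fun _ h => h.2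
      rw [h3.fderiv_eq]
      exact (h2.of_le (m := 2) h2k).isSymmSndFDerivAt (by simp) _ _
    -- Differentiating `H ∘ Φ = H x₀ + t` pairs the field `X` with `∂/∂t` alone; this is the source
    -- of the new conjugate pair.
    have hΦHd : ∀ᶠ p in 𝓝 ((0 : ℝ), (0 : EuclideanSpace ℝ (Fin (2 * d)))),
        ∀ w, B (Φ p) (X (Φ p)) (fderiv ℝ Φ p w) = w.1 := by
      have hΦc := hΦ.contDiffAt.self_of_nhds.continuousAt
      filter_upwards [hΦH.eventually_nhds, hΦ.contDiffAt, hΦc.eventually hH, hΦc.eventually hX]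
        with p h1 h2 h3 h4 w
      have h5 : HasFDerivAt (fun q => H (Φ q)) ((fderiv ℝ H (Φ p)).comp (fderiv ℝ Φ p)) p :=
        (h3.differentiableAt hk1).hasFDerivAt.comp p (h2.differentiableAt hk').hasFDerivAt
      have h6 : HasFDerivAt (fun q => H (Φ q))
          (ContinuousLinearMap.fst ℝ ℝ (EuclideanSpace ℝ (Fin (2 * d)))) p :=
        (hasFDerivAt_fst.const_add (H x₀)).congr_of_eventuallyEq h1
      rw [h4.2]
      exact congrArg (fun l => l w) (h5.unique h6)
    filter_upwards [hΞ.eventually_pullback_eq hk (hX.mono fun _ h => h.1) hB hα,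
      hsnd'.eventually hΦB, hsnd'.eventually hΦHd] with q h1 h2 h3 w w'
    rw [h1, h2, h3, h3]
  -- conclusion
  have hsplit : Tendsto (splitPair d) (𝓝 0) (𝓝 (0, (0, 0))) := by
    have := (splitPair d).continuous.tendsto 0
    rwa [map_zero] at this
  have hΞd : ∀ᶠ y in 𝓝 (0 : EuclideanSpace ℝ (Fin (2 * (d + 1)))),
      fderiv ℝ (fun y => Ξ (splitPair d y)) y = (fderiv ℝ Ξ (splitPair d y)).comp (splitPair d) := by
    filter_upwards [hsplit.eventually hΞ.contDiffAt] with y hy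
    exact ((hy.differentiableAt hk').hasFDerivAt.comp y (splitPair d).hasFDerivAt).fderiv
  refine ⟨fun y => Ξ (splitPair d y), ⟨?_, ?_, ?_⟩, ?_, ?_⟩
  · have h1 : splitPair d 0 = (0, (0, 0)) := map_zero _
    rw [h1, hΞ.initial.self_of_nhds, hΦ₀, hθ0]
  · filter_upwards [hsplit.eventually hΞ.contDiffAt] with y hy
    exact hy.comp y (splitPair d).contDiff.contDiffAt
  · filter_upwards [hΞd, hsplit.eventually hΞB] with y h1 h2 w w'
    rw [h1, ContinuousLinearMap.comp_apply, ContinuousLinearMap.comp_apply, h2, canonicalForm_succ]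
    rfl
  · exact hsplit.eventually hΞH
  · filter_upwards [hΞd, hsplit.eventually hΞ.fderiv_time,
      hsplit.eventually (hΞ.tendsto.eventually hX)] with y h1 h2 h3
    rw [h1, ContinuousLinearMap.comp_apply, splitPair_partialOne, h2, h3.2]

/-- Any function with nonzero differential can play the role of `H`; a nonzero linear form is smooth
enough for every `k`. -/
theorem darbouxStatement {k : ℕ∞} (hk : k ≠ 0) (d : ℕ) : DarbouxStatement k d := by
  induction d with
  | zero =>
    intro V _ _ _ B x₀ hV hB
    have : Subsingleton V := Module.finrank_zero_iff.1 (by simpa using hV)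
    refine ⟨fun _ => x₀, rfl, Eventually.of_forall fun _ => contDiffAt_const,
      Eventually.of_forall fun y w w' => ?_⟩
    rw [Subsingleton.elim (fderiv ℝ (fun _ => x₀) y w) 0]
    rw [canonicalForm_apply]
    simp
  | succ d ih =>
    intro V _ _ _ B x₀ hV hB
    have : Nontrivial V := Module.nontrivial_of_finrank_pos (R := ℝ) (by omega)
    obtain ⟨v, hv⟩ := exists_ne (0 : V)
    obtain ⟨L, -, hL⟩ := _root_.exists_dual_vector ℝ v (norm_ne_zero_iff.2 hv)
    obtain ⟨Ψ, hΨ, -⟩ := exists_flowbox_of_darboux hk ih hV hB (H := L)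
      (Eventually.of_forall fun _ => L.contDiff.contDiffAt) (by
        rw [L.fderiv]
        rintro rfl
        simp only [zero_apply] at hL
        exact hv (norm_eq_zero.1 (by exact_mod_cast hL.symm)))
    exact ⟨Ψ, hΨ⟩

end Induction

/-! ### From the parametrization to a local diffeomorphism, in a vector space -/

section Flowbox

theorem lowIdx_injective {d : ℕ} : Function.Injective (lowIdx (d := d)) := fun i j h => by
  simpa [lowIdx, Fin.ext_iff] using h

theorem highIdx_injective {d : ℕ} : Function.Injective (highIdx (d := d)) := fun i j h => by
  simpa [highIdx, Fin.ext_iff] using h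

theorem lowIdx_ne_highIdx {d : ℕ} (i j : Fin d) : lowIdx i ≠ highIdx j := by
  simp only [lowIdx, highIdx, ne_eq, Fin.ext_iff]
  omega

theorem eq_lowIdx_or_eq_highIdx {d : ℕ} (j : Fin (2 * d)) :
    (∃ i, j = lowIdx i) ∨ ∃ i, j = highIdx i := by
  by_cases h : (j : ℕ) < d
  · exact Or.inl ⟨⟨j, h⟩, rfl⟩
  · refine Or.inr ⟨⟨j - d, by omega⟩, ?_⟩
    simp only [highIdx, Fin.ext_iff]
    omega

theorem canonicalForm_nondegenerate {d : ℕ} {w : EuclideanSpace ℝ (Fin (2 * d))}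
    (h : ∀ w', canonicalForm d ![w, w'] = 0) : w = 0 := by
  ext j
  rcases eq_lowIdx_or_eq_highIdx j with ⟨i, rfl⟩ | ⟨i, rfl⟩
  · have := h (EuclideanSpace.single (highIdx i) 1)
    simpa [canonicalForm_apply, Pi.single_apply, lowIdx_ne_highIdx, highIdx_injective.eq_iff]
      using this
  · have := h (EuclideanSpace.single (lowIdx i) 1)
    simpa [canonicalForm_apply, Pi.single_apply, (lowIdx_ne_highIdx _ _).symm,
      lowIdx_injective.eq_iff] using this

/-- The flowbox theorem for a symplectic form and a Hamiltonian near a point of a vector space. -/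
theorem exists_flowbox_diffeomorph {V : Type} [NormedAddCommGroup V] [NormedSpace ℝ V]
    [FiniteDimensional ℝ V] {k : ℕ∞} (hk : k ≠ 0) {d : ℕ} [NeZero d]
    {B : V → V →L[ℝ] V →L[ℝ] ℝ} {x₀ : V} (hV : Module.finrank ℝ V = 2 * d)
    (hB : IsSymplecticNear k B x₀) {H : V → ℝ}
    (hH : ∀ᶠ x in 𝓝 x₀, ContDiffAt ℝ (k + 1 : ℕ∞) H x) (hdH : fderiv ℝ H x₀ ≠ 0) :
    ∃ g : OpenPartialHomeomorph (EuclideanSpace ℝ (Fin (2 * d))) V, x₀ ∈ g.target ∧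
      (∀ x ∈ g.target, ContDiffAt ℝ k g.symm x) ∧
      ∀ y ∈ g.source, ContDiffAt ℝ k g y ∧
        (∀ w w', B (g y) (fderiv ℝ g y w) (fderiv ℝ g y w') = canonicalForm d ![w, w']) ∧
        H (g y) = y (highIdx 0) ∧ B (g y) (fderiv ℝ g y (partialOne d)) = fderiv ℝ H (g y) := by
  obtain ⟨d, rfl⟩ := Nat.exists_eq_succ_of_ne_zero (NeZero.ne d)
  have hk' : (k : WithTop ℕ∞) ≠ 0 := by exact_mod_cast hk
  obtain ⟨Ψ, hΨ, hΨH, hΨX⟩ := exists_flowbox_of_darboux hk (darbouxStatement hk d) hV hB hH hdH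
  -- Translating the coordinate `y_{d+1}` absorbs the constant `H x₀`, so that `H` becomes exactly
  -- that coordinate.
  set a : EuclideanSpace ℝ (Fin (2 * (d + 1))) := EuclideanSpace.single (highIdx 0) (H x₀)
  have hsub : Tendsto (fun y => y - a) (𝓝 a) (𝓝 0) := by
    have : Continuous fun y => y - a := by fun_prop
    simpa using this.tendsto a
  set Θ : EuclideanSpace ℝ (Fin (2 * (d + 1))) → V := fun y => Ψ (y - a) with hΘ
  have hΘd : ∀ y, fderiv ℝ Θ y = fderiv ℝ Ψ (y - a) := fun y => fderiv_comp_sub a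
  have hΘa : Θ a = x₀ := by simp [hΘ, hΨ.map_zero]
  have hsm : ∀ᶠ y in 𝓝 a, ContDiffAt ℝ k Θ y := by
    filter_upwards [hsub.eventually hΨ.contDiffAt] with y hy
    exact hy.comp y (contDiffAt_id.sub contDiffAt_const)
  have hpb : ∀ᶠ y in 𝓝 a, ∀ w w',
      B (Θ y) (fderiv ℝ Θ y w) (fderiv ℝ Θ y w') = canonicalForm (d + 1) ![w, w'] := by
    filter_upwards [hsub.eventually hΨ.pullback_eq] with y hy
    rw [hΘd]
    exact hy
  have hp : ∀ᶠ y in 𝓝 a,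
      (∀ w w', B (Θ y) (fderiv ℝ Θ y w) (fderiv ℝ Θ y w') = canonicalForm (d + 1) ![w, w']) ∧
      H (Θ y) = y (highIdx 0) ∧
      B (Θ y) (fderiv ℝ Θ y (partialOne (d + 1))) = fderiv ℝ H (Θ y) := by
    filter_upwards [hpb, hsub.eventually hΨH, hsub.eventually hΨX] with y h2 h3 h4
    refine ⟨h2, ?_, by rw [hΘd]; exact h4⟩
    rw [hΘ]
    simp only
    rw [h3]
    simp [a]
  -- A map pulling a form back to a nondegenerate one has injective derivative; equality of
  -- dimensions makes it invertible.
  have hinj : Function.Injective (fderiv ℝ Θ a) := by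
    rw [injective_iff_map_eq_zero]
    intro w hw
    refine canonicalForm_nondegenerate fun w' => ?_
    rw [← hpb.self_of_nhds, hw]
    simp
  let e : EuclideanSpace ℝ (Fin (2 * (d + 1))) ≃L[ℝ] V :=
    (LinearEquiv.ofInjectiveOfFinrankEq
      (fderiv ℝ Θ a : EuclideanSpace ℝ (Fin (2 * (d + 1))) →ₗ[ℝ] V) hinj
      (by rw [hV]; simp)).toContinuousLinearEquiv
  have he : (e : EuclideanSpace ℝ (Fin (2 * (d + 1))) →L[ℝ] V) = fderiv ℝ Θ a := by ext; rfl
  obtain ⟨g, hg, ha, hsrc, htgt⟩ := exists_local_diffeomorph hk' hsm (f' := e)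
    (by rw [he]; exact (hsm.self_of_nhds.differentiableAt hk').hasFDerivAt) hp
  refine ⟨g, ?_, htgt, ?_⟩
  · have := g.map_source ha
    rwa [hg, hΘa] at this
  · intro y hy
    rw [hg]
    exact hsrc y hy

/-- The bilinear form underlying an alternating form of degree two. -/
def toBilin {V : Type*} [NormedAddCommGroup V] [NormedSpace ℝ V] (η : V [⋀^Fin 2]→L[ℝ] ℝ) :
    V →L[ℝ] V →L[ℝ] ℝ :=
  have e0 : ∀ a b v : V, Function.update ![a, v] 0 b = ![b, v] := fun a b v => by
    funext i; fin_cases i <;> rfl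
  have e1 : ∀ a v b : V, Function.update ![a, v] 1 b = ![a, b] := fun a v b => by
    funext i; fin_cases i <;> rfl
  LinearMap.mkContinuous₂
    (LinearMap.mk₂ ℝ (fun u v => η ![u, v])
      (fun a b v => by simpa only [e0] using η.map_update_add ![a, v] 0 a b)
      (fun r a v => by simpa only [e0] using η.map_update_smul ![a, v] 0 r a)
      (fun a v w => by simpa only [e1] using η.map_update_add ![a, v] 1 v w)
      (fun r a v => by simpa only [e1] using η.map_update_smul ![a, v] 1 r v)) ‖η‖
    (fun u v => by
      have := η.le_opNorm ![u, v]
      simpa [Fin.prod_univ_two, mul_assoc] using this)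

@[simp]
theorem toBilin_apply {V : Type*} [NormedAddCommGroup V] [NormedSpace ℝ V]
    (η : V [⋀^Fin 2]→L[ℝ] ℝ) (u v : V) : toBilin η u v = η ![u, v] := rfl

/-- The alternating sum defining `extDeriv` becomes the cyclic sum of `IsClosedAt` after exchanging
the two arguments in its middle term. -/
theorem isSymplecticNear_toBilin {V : Type*} [NormedAddCommGroup V] [NormedSpace ℝ V]
    [FiniteDimensional ℝ V] {k : ℕ∞} (hk : k ≠ 0) {η : V → V [⋀^Fin 2]→L[ℝ] ℝ} {s : Set V}
    (hs : IsOpen s) (hη : ContDiffOn ℝ k η s) (hcl : ∀ y ∈ s, extDeriv η y = 0) {x₀ : V}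
    (hx₀ : x₀ ∈ s) (hnd : ∀ u, (∀ v, η x₀ ![u, v] = 0) → u = 0) :
    IsSymplecticNear k (fun y => toBilin (η y)) x₀ := by
  have hk' : (k : WithTop ℕ∞) ≠ 0 := by exact_mod_cast hk
  have halt : ∀ (x u : V), toBilin (η x) u u = 0 := fun x u =>
    (η x).map_eq_zero_of_eq ![u, u] (i := 0) (j := 1) rfl (by decide)
  have hsm : ∀ y ∈ s, ContDiffAt ℝ k (fun y => toBilin (η y)) y := by
    have : ContDiffOn ℝ k (fun y => toBilin (η y)) s := by
      rw [contDiffOn_clm_apply]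
      intro u
      rw [contDiffOn_clm_apply]
      intro v
      exact (ContinuousAlternatingMap.apply ℝ V ℝ ![u, v]).contDiff.comp_contDiffOn hη
    exact fun y hy => this.contDiffAt (hs.mem_nhds hy)
  refine ⟨halt, ?_, ?_, hnd⟩
  · filter_upwards [hs.mem_nhds hx₀] with y hy using hsm y hy
  · filter_upwards [hs.mem_nhds hx₀] with y hy u v w
    have hd := (hsm y hy).differentiableAt hk'
    have hηd : DifferentiableAt ℝ η y := (hη.contDiffAt (hs.mem_nhds hy)).differentiableAt hk'
    have h1 : ∀ u v w : V, fderiv ℝ (fun y => η y ![v, w]) y u =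
        fderiv ℝ (fun y => toBilin (η y)) y u v w := by
      intro u v w
      have := fderiv_clm_apply_apply hd (differentiableAt_const v) (differentiableAt_const w) u
      rw [fderiv_const_apply, fderiv_const_apply] at this
      simpa only [toBilin_apply, zero_apply, map_zero, add_zero] using this
    have h2 := (Fin.sum_univ_three _).symm.trans ((extDeriv_apply hηd ![u, v, w]).symm.trans
      (congrArg (fun l => l ![u, v, w]) (hcl y hy)))
    have r0 : (0 : Fin 3).removeNth ![u, v, w] = ![v, w] := by
      funext i; fin_cases i <;> rfl
    have r1 : (1 : Fin 3).removeNth ![u, v, w] = ![u, w] := by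
      funext i; fin_cases i <;> rfl
    have r2 : (2 : Fin 3).removeNth ![u, v, w] = ![u, v] := by
      funext i; fin_cases i <;> rfl
    rw [r0, r1, r2, h1, h1, h1] at h2
    have h3 := fderiv_antisymm halt hd v w u
    simp at h2
    linarith

end Flowbox

/-! ### Transfer to manifolds -/

section Transfer

variable {d : ℕ} {M : Type*} [TopologicalSpace M]
  [ChartedSpace (EuclideanSpace ℝ (Fin (2 * d))) M]

theorem mfderiv_chart_symm_comp [IsManifold (𝓡 (2 * d)) 1 M] (x : M) {m : M}
    (hm : m ∈ (chartAt (EuclideanSpace ℝ (Fin (2 * d))) x).source)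
    (v : TangentSpace (𝓡 (2 * d)) m) :
    mfderiv 𝓘(ℝ, EuclideanSpace ℝ (Fin (2 * d))) (𝓡 (2 * d))
        (extChartAt (𝓡 (2 * d)) x).symm (extChartAt (𝓡 (2 * d)) x m)
        (mfderiv (𝓡 (2 * d)) 𝓘(ℝ, EuclideanSpace ℝ (Fin (2 * d)))
          (extChartAt (𝓡 (2 * d)) x) m v) = v := by
  have h := mfderivWithin_extChartAt_symm_comp_mfderiv_extChartAt' (I := 𝓡 (2 * d)) (x := x)
    (y := m) (by rwa [extChartAt_source])
  rw [ModelWithCorners.range_eq_univ, mfderivWithin_univ] at h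
  exact congrArg (fun l => l v) h

theorem mfderiv_chart_comp_symm [IsManifold (𝓡 (2 * d)) 1 M] (x : M) {m : M}
    (hm : m ∈ (chartAt (EuclideanSpace ℝ (Fin (2 * d))) x).source)
    (v : EuclideanSpace ℝ (Fin (2 * d))) :
    mfderiv (𝓡 (2 * d)) 𝓘(ℝ, EuclideanSpace ℝ (Fin (2 * d))) (extChartAt (𝓡 (2 * d)) x) m
      (mfderiv 𝓘(ℝ, EuclideanSpace ℝ (Fin (2 * d))) (𝓡 (2 * d))
        (extChartAt (𝓡 (2 * d)) x).symm (extChartAt (𝓡 (2 * d)) x m) v) = v := by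
  have h := mfderiv_extChartAt_comp_mfderivWithin_extChartAt_symm' (I := 𝓡 (2 * d)) (x := x)
    (y := m) (by rwa [extChartAt_source])
  rw [ModelWithCorners.range_eq_univ, mfderivWithin_univ] at h
  exact congrArg (fun l => l v) h

theorem inChart_apply (η : TwoForm (𝓡 (2 * d)) M) (x : M) {m : M}
    (hm : m ∈ (chartAt (EuclideanSpace ℝ (Fin (2 * d))) x).source)
    (u v : EuclideanSpace ℝ (Fin (2 * d))) :
    inChart (𝓡 (2 * d)) η x (extChartAt (𝓡 (2 * d)) x m) ![u, v] =
      η m ![mfderiv 𝓘(ℝ, EuclideanSpace ℝ (Fin (2 * d))) (𝓡 (2 * d))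
          (extChartAt (𝓡 (2 * d)) x).symm (extChartAt (𝓡 (2 * d)) x m) u,
        mfderiv 𝓘(ℝ, EuclideanSpace ℝ (Fin (2 * d))) (𝓡 (2 * d))
          (extChartAt (𝓡 (2 * d)) x).symm (extChartAt (𝓡 (2 * d)) x m) v] := by
  have h : (extChartAt (𝓡 (2 * d)) x).symm (extChartAt (𝓡 (2 * d)) x m) = m :=
    (extChartAt (𝓡 (2 * d)) x).left_inv (by rwa [extChartAt_source])
  -- The base point is generalized because the type of `η m` depends on it; all tangent spaces are
  -- read as the model space.
  have key : ∀ m' : M, m' = m → ∀ D : EuclideanSpace ℝ (Fin (2 * d)) →L[ℝ]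
      EuclideanSpace ℝ (Fin (2 * d)),
      ((η m' : (EuclideanSpace ℝ (Fin (2 * d))) [⋀^Fin 2]→L[ℝ] ℝ).compContinuousLinearMap D)
        ![u, v] = (η m : (EuclideanSpace ℝ (Fin (2 * d))) [⋀^Fin 2]→L[ℝ] ℝ) ![D u, D v] := by
    rintro m' rfl D
    change (η m' : (EuclideanSpace ℝ (Fin (2 * d))) [⋀^Fin 2]→L[ℝ] ℝ) (D ∘ ![u, v]) = _
    congr 1
    funext i
    fin_cases i <;> rfl
  exact key _ h _

theorem fderiv_comp_chart_symm [IsManifold (𝓡 (2 * d)) 1 M] (x : M) {m : M}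
    (hm : m ∈ (chartAt (EuclideanSpace ℝ (Fin (2 * d))) x).source) {H : M → ℝ}
    (hH : MDifferentiableAt (𝓡 (2 * d)) 𝓘(ℝ, ℝ) H m) (v : EuclideanSpace ℝ (Fin (2 * d))) :
    fderiv ℝ (fun y => H ((extChartAt (𝓡 (2 * d)) x).symm y)) (extChartAt (𝓡 (2 * d)) x m) v =
      differential (d := d) H m (mfderiv 𝓘(ℝ, EuclideanSpace ℝ (Fin (2 * d))) (𝓡 (2 * d))
          (extChartAt (𝓡 (2 * d)) x).symm (extChartAt (𝓡 (2 * d)) x m) v) := by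
  have hm' : m ∈ (extChartAt (𝓡 (2 * d)) x).source := by rwa [extChartAt_source]
  have h : (extChartAt (𝓡 (2 * d)) x).symm (extChartAt (𝓡 (2 * d)) x m) = m :=
    (extChartAt (𝓡 (2 * d)) x).left_inv hm'
  have hd : MDifferentiableAt 𝓘(ℝ, EuclideanSpace ℝ (Fin (2 * d))) (𝓡 (2 * d))
      (extChartAt (𝓡 (2 * d)) x).symm (extChartAt (𝓡 (2 * d)) x m) := by
    have := mdifferentiableWithinAt_extChartAt_symm (I := 𝓡 (2 * d)) (x := x)
      ((extChartAt (𝓡 (2 * d)) x).map_source hm')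
    rwa [ModelWithCorners.range_eq_univ, mdifferentiableWithinAt_univ] at this
  have hH' : HasMFDerivAt (𝓡 (2 * d)) 𝓘(ℝ, ℝ) H
      ((extChartAt (𝓡 (2 * d)) x).symm (extChartAt (𝓡 (2 * d)) x m))
      (mfderiv (𝓡 (2 * d)) 𝓘(ℝ, ℝ) H m) := by
    rw [h]
    exact hH.hasMFDerivAt
  have h3 := (hH'.comp _ hd.hasMFDerivAt).mfderiv
  rw [mfderiv_eq_fderiv] at h3
  exact congrArg (fun l => l v) h3

end Transfer

end SymplecticFlowbox

end

/-! ### The flowbox theorem on the manifold -/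

open SymplecticFlowbox Filter Topology in
theorem mainTheorem4 (d : ℕ) [NeZero d] (s : ℕ∞) (hs : 2 ≤ s)
    (M : Type*) [TopologicalSpace M] [ChartedSpace (EuclideanSpace ℝ (Fin (2 * d))) M]
    [IsManifold (𝓡 (2 * d)) (s : WithTop ℕ∞) M]
    (ω : SymplecticFlowbox.SymplecticForm d ((s - 1 : ℕ∞) : WithTop ℕ∞) M)
    (H : M → ℝ) (hH : ContMDiff (𝓡 (2 * d)) 𝓘(ℝ, ℝ) (s : WithTop ℕ∞) H)
    (x : M) (hx : SymplecticFlowbox.IsRegularPoint d H x) :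
    ∃ g : OpenPartialHomeomorph M (EuclideanSpace ℝ (Fin (2 * d))),
      x ∈ g.source ∧
      SymplecticFlowbox.IsLocalSymplectomorphism ω ((s - 1 : ℕ∞) : WithTop ℕ∞) g ∧
      (∀ m ∈ g.source, H m = SymplecticFlowbox.H₀ d (g m)) ∧
      (∀ m ∈ g.source,
        mfderiv (𝓡 (2 * d)) (𝓡 (2 * d)) g m (SymplecticFlowbox.hamiltonianVectorField ω H m)
          = SymplecticFlowbox.partialOne d) := by
  have hs1 : s - 1 + 1 = s := tsub_add_cancel_of_le (one_le_two.trans hs)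
  revert ω
  -- Writing `s = k + 1` removes the truncated subtraction and treats `s = ∞` uniformly, with `k =
  -- ∞`.
  generalize s - 1 = k at hs1
  subst hs1
  intro ω
  have hk : k ≠ 0 := by
    rintro rfl
    exact absurd hs (by simp)
  have hk' : (k : WithTop ℕ∞) ≠ 0 := by exact_mod_cast hk
  have h1s : (1 : WithTop ℕ∞) ≤ (k + 1 : ℕ∞) := by exact_mod_cast (le_add_self : 1 ≤ k + 1)
  have hks' : (k : WithTop ℕ∞) ≤ (k + 1 : ℕ∞) := by exact_mod_cast (le_self_add : k ≤ k + 1)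
  have hM1 : IsManifold (𝓡 (2 * d)) 1 M := IsManifold.of_le h1s
  have hMk : IsManifold (𝓡 (2 * d)) (k : WithTop ℕ∞) M := IsManifold.of_le hks'
  set c := chartAt (EuclideanSpace ℝ (Fin (2 * d))) x with hc
  have hxc : x ∈ c.source := mem_chart_source _ x
  have hopen : IsOpen (extChartAt (𝓡 (2 * d)) x).target := isOpen_extChartAt_target x
  set D : M → EuclideanSpace ℝ (Fin (2 * d)) →L[ℝ] EuclideanSpace ℝ (Fin (2 * d)) := fun m =>
    mfderiv 𝓘(ℝ, EuclideanSpace ℝ (Fin (2 * d))) (𝓡 (2 * d))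
      (extChartAt (𝓡 (2 * d)) x).symm (extChartAt (𝓡 (2 * d)) x m) with hD
  set C : M → EuclideanSpace ℝ (Fin (2 * d)) →L[ℝ] EuclideanSpace ℝ (Fin (2 * d)) := fun m =>
    mfderiv (𝓡 (2 * d)) 𝓘(ℝ, EuclideanSpace ℝ (Fin (2 * d))) (extChartAt (𝓡 (2 * d)) x) m
    with hC
  have hDC : ∀ m ∈ c.source, ∀ v, D m (C m v) = v := fun m hm v => mfderiv_chart_symm_comp x hm v
  have hCD : ∀ m ∈ c.source, ∀ v, C m (D m v) = v := fun m hm v => mfderiv_chart_comp_symm x hm v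
  set B : EuclideanSpace ℝ (Fin (2 * d)) → _ := fun y => toBilin (inChart (𝓡 (2 * d)) ω.form x y)
    with hBdef
  -- The form, the differential and the field are retyped on the model space, to which every tangent
  -- space is definitionally equal.
  set Ω : M → (EuclideanSpace ℝ (Fin (2 * d))) [⋀^Fin 2]→L[ℝ] ℝ := ω.form 
  set dH : M → EuclideanSpace ℝ (Fin (2 * d)) →L[ℝ] ℝ := differential H with hdH
  set X : M → EuclideanSpace ℝ (Fin (2 * d)) := hamiltonianVectorField ω H with hX
  have hΩnd : ∀ (m : M) (u : EuclideanSpace ℝ (Fin (2 * d))),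
      (∀ v : EuclideanSpace ℝ (Fin (2 * d)), Ω m ![u, v] = 0) → u = 0 := ω.nondegenerate
  have hXspec : ∀ (m : M) (v : EuclideanSpace ℝ (Fin (2 * d))), Ω m ![X m, v] = dH m v :=
    hamiltonianVectorField_spec ω H
  have hBapply : ∀ m ∈ c.source, ∀ u v, B (c m) u v = Ω m ![D m u, D m v] :=
    fun m hm u v => inChart_apply ω.form x hm u v
  have hB : IsSymplecticNear k B (c x) := by
    refine isSymplecticNear_toBilin hk hopen (ω.contDiffOn x) (ω.closed x)
      (mem_extChartAt_target x) fun u hu => ?_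
    have h1 : D x u = 0 := hΩnd x (D x u) fun v => by
      have := hBapply x hxc u (C x v)
      rw [hDC x hxc] at this
      rw [← this]
      exact hu _
    rw [← hCD x hxc u, h1, map_zero]
  set K : EuclideanSpace ℝ (Fin (2 * d)) → ℝ := fun y => H ((extChartAt (𝓡 (2 * d)) x).symm y)
    with hKdef
  have hKd : ∀ m ∈ c.source, ∀ v, fderiv ℝ K (c m) v = dH m (D m v) :=
    fun m hm v => fderiv_comp_chart_symm x hm
      (hH.mdifferentiable ((zero_lt_one.trans_le h1s).ne') m) v
  have hK : ∀ᶠ y in 𝓝 (c x), ContDiffAt ℝ (k + 1 : ℕ∞) K y := by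
    filter_upwards [hopen.mem_nhds (mem_extChartAt_target x)] with y hy
    have := hH.comp_contMDiffOn (contMDiffOn_extChartAt_symm (n := (k + 1 : ℕ∞)) x)
    exact (contMDiffOn_iff_contDiffOn.1 this).contDiffAt (hopen.mem_nhds hy)
  have hdK : fderiv ℝ K (c x) ≠ 0 := by
    intro h
    have hzero : ∀ v : EuclideanSpace ℝ (Fin (2 * d)), dH x v = 0 := fun v => by
      have := hKd x hxc (C x v)
      rw [hDC x hxc, h] at this
      exact this.symm
    exact hx (ContinuousLinearMap.ext hzero)
  have hdim : Module.finrank ℝ (EuclideanSpace ℝ (Fin (2 * d))) = 2 * d := by simp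
  obtain ⟨Θ, hxΘ, hΘsymm, hΘ⟩ := exists_flowbox_diffeomorph hk hdim hB hK hdK
  set g : OpenPartialHomeomorph M (EuclideanSpace ℝ (Fin (2 * d))) := c.trans Θ.symm with hg
  have hsource : ∀ m ∈ g.source, m ∈ c.source ∧ c m ∈ Θ.target := fun m hm => by
    simpa [hg] using hm
  have hgsm : ∀ m ∈ g.source, ContMDiffAt (𝓡 (2 * d)) (𝓡 (2 * d)) k g m := by
    intro m hm
    obtain ⟨h1, h2⟩ := hsource m hm
    have hcm : ContMDiffAt (𝓡 (2 * d)) (𝓡 (2 * d)) k c m :=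
      contMDiffAt_of_mem_maximalAtlas (IsManifold.chart_mem_maximalAtlas x) h1
    have hΘm : ContMDiffAt (𝓡 (2 * d)) (𝓡 (2 * d)) k Θ.symm (c m) := (hΘsymm _ h2).contMDiffAt
    exact hΘm.comp m hcm
  set A : M → EuclideanSpace ℝ (Fin (2 * d)) →L[ℝ] EuclideanSpace ℝ (Fin (2 * d)) := fun m =>
    mfderiv (𝓡 (2 * d)) (𝓡 (2 * d)) g m with hA
  have hmain : ∀ m ∈ g.source, Θ (g m) = c m ∧ g m ∈ Θ.source ∧
      ∀ v : EuclideanSpace ℝ (Fin (2 * d)), fderiv ℝ Θ (g m) (A m v) = C m v := by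
    intro m hm
    obtain ⟨h1, h2⟩ := hsource m hm
    have h3 : g m ∈ Θ.source := Θ.map_target h2
    refine ⟨Θ.right_inv h2, h3, fun v => ?_⟩
    have h4 : MDifferentiableAt (𝓡 (2 * d)) (𝓡 (2 * d)) Θ (g m) :=
      ((hΘ _ h3).1.differentiableAt hk').mdifferentiableAt
    have h5 := mfderiv_comp m h4 ((hgsm m hm).mdifferentiableAt hk')
    -- Differentiating this identity relates `Dg` to the derivatives of `Θ` and of the chart,
    -- without inverting `DΘ`.
    have h6 : Θ ∘ g =ᶠ[𝓝 m] extChartAt (𝓡 (2 * d)) x := by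
      filter_upwards [g.open_source.mem_nhds hm] with m' hm'
      exact Θ.right_inv (hsource m' hm').2
    rw [h6.mfderiv_eq, mfderiv_eq_fderiv] at h5
    exact (congrArg (fun l => l v) h5).symm
  have hsymp : ∀ m ∈ g.source, ∀ u v : EuclideanSpace ℝ (Fin (2 * d)),
      canonicalForm d ![A m u, A m v] = Ω m ![u, v] := by
    intro m hm u v
    obtain ⟨h1, h2⟩ := hsource m hm
    obtain ⟨h3, h4, h5⟩ := hmain m hm
    rw [← (hΘ _ h4).2.1, h5, h5, h3, hBapply m h1, hDC m h1, hDC m h1]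
  refine ⟨g, by simp [hg, hxc, hxΘ], ⟨?_, ?_, ?_⟩, ?_, ?_⟩
  · exact fun m hm => (hgsm m hm).contMDiffWithinAt
  · intro y hy
    have hy' : y ∈ Θ.source ∧ Θ y ∈ c.target := by simpa [hg] using hy
    have hcm : ContMDiffAt (𝓡 (2 * d)) (𝓡 (2 * d)) k c.symm (Θ y) :=
      contMDiffAt_symm_of_mem_maximalAtlas (IsManifold.chart_mem_maximalAtlas x) hy'.2
    have hΘy : ContMDiffAt (𝓡 (2 * d)) (𝓡 (2 * d)) k Θ y := (hΘ y hy'.1).1.contMDiffAt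
    exact (hcm.comp y hΘy).contMDiffWithinAt
  · intro m hm
    have h : ∀ v : Fin 2 → EuclideanSpace ℝ (Fin (2 * d)),
        (canonicalForm d).compContinuousLinearMap (A m) v = Ω m v := by
      intro v
      have hv : v = ![v 0, v 1] := by funext i; fin_cases i <;> rfl
      rw [hv, ← hsymp m hm]
      change canonicalForm d (A m ∘ ![v 0, v 1]) = _
      congr 1
      funext i
      fin_cases i <;> rfl
    exact ContinuousAlternatingMap.ext h
  · intro m hm
    obtain ⟨h1, h2⟩ := hsource m hm
    obtain ⟨h3, h4, h5⟩ := hmain m hm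
    have h6 := (hΘ _ h4).2.2.1
    rw [h3] at h6
    rw [H₀, ← h6]
    exact congrArg H (c.left_inv h1).symm
  · intro m hm
    obtain ⟨h1, h2⟩ := hsource m hm
    obtain ⟨h3, h4, h5⟩ := hmain m hm
    obtain ⟨-, h6, -, h7⟩ := hΘ _ h4
    rw [h3] at h6 h7
    set Z := fderiv ℝ Θ (g m) (partialOne d) with hZ
    -- Both vectors contract with `ω` to `dH`, so nondegeneracy identifies the push-forward of
    -- `∂/∂y_1` with `X_H`.
    have h8 : D m Z = X m := by
      rw [← sub_eq_zero]
      refine hΩnd m _ fun v => ?_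
      have h9 := hBapply m h1 Z (C m v)
      rw [h7, hKd m h1, hDC m h1, ← hXspec] at h9
      rw [← toBilin_apply, map_sub, sub_apply, toBilin_apply, toBilin_apply, h9, sub_self]
    have h10 : A m (X m) = partialOne d := by
      rw [← sub_eq_zero]
      refine canonicalForm_nondegenerate fun w' => ?_
      rw [← h6, map_sub, h5, ← h8, hCD m h1, hZ, sub_self, map_zero, zero_apply]
    exact h10
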